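/- Let $L>0$, $h>0$, $\alpha\in\mathbb R$ and $\beta>0$ satisfy $$0<2\alpha^2+\tfrac32\beta<\tfrac12 .$$ Let $H=[L^2(0,L)]^2\times L^2(0,1)$ (real-valued functions) be equipped with the inner product $$\langle (u,v,z),(\bar u,\bar v,\bar z)\rangle_H=\int_0^L (u\bar u+v\bar v)\,dx+\beta h\int_0^1 z\bar z\,d\rho ,$$ and let $A\colon D(A)\subset H\to H$ be the operator $$A(u,v,z)=\left(\tfrac12 u_{xxx},\,-v_{xxx},\,-\tfrac1h z_\rho\right)$$ with domain $$D(A)=\left\{(u,v,z)\;:\; u,v\in H^3(0,L)\cap H^1_0(0,L),\ z\in H^1(0,1),\ u_x(0)=0,\ z(0)=u_x(L),\ v_x(L)=\alpha u_x(L)+\beta z(1)\right\}.$$ Then $A$ generates a strongly continuous ($C_0$) semigroup of contractions on $H$: there is a family $(S(t))_{t\ge 0}$ of bounded linear operators on $H$ with $S(0)=I$, $S(s+t)=S(s)S(t)$ for all $s,t\ge 0$, $S(t)U\to U$ as $t\downarrow 0$ for every $U\in H$, and $\|S(t)\|\le 1$ for all $t\ge 0$ (in the norm of the above inner product), whose infinitesimal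 generator is exactly $A$; that is, $U\in D(A)$ and $AU=W$ if and only if $\lim_{t\downarrow 0}(S(t)U-U)/t=W$ in $H$. -/

import Mathlib

open MeasureTheory Set Filter Topology
open scoped NNReal ENNReal ContDiff

/-! ### Strongly continuous semigroups and their generators -/

section Semigroup

variable {X : Type*} [NormedAddCommGroup X] [NormedSpace ℝ X]

/-- `(S t)_{t ≥ 0}` is a strongly continuous (C₀) semigroup of bounded operators on `X`. -/
structure IsC0Semigroup (S : ℝ≥0 → X →L[ℝ] X) : Prop where
  map_zero : S 0 = ContinuousLinearMap.id ℝ X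
  map_add : ∀ s t, S (s + t) = (S s).comp (S t)
  tendsto_zero : ∀ x, Tendsto (fun t => S t x) (𝓝[>] 0) (𝓝 x)

/-- A C₀ semigroup of contractions. -/
structure IsC0ContractionSemigroup (S : ℝ≥0 → X →L[ℝ] X) : Prop extends IsC0Semigroup S where
  norm_le_one : ∀ t, ‖S t‖ ≤ 1

/-- The (unbounded) operator `A` is the infinitesimal generator of `S`: one has `x ∈ D(A)` and
`A x = y` exactly when `(S t x - x) / t` converges to `y` in norm as `t ↓ 0`.  In particular
`D(A)` is exactly the set of those `x` for which this limit exists. -/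
def IsInfinitesimalGenerator (A : X →ₗ.[ℝ] X) (S : ℝ≥0 → X →L[ℝ] X) : Prop :=
  ∀ x y : X, (x, y) ∈ A.graph ↔
    Tendsto (fun t : ℝ≥0 => (t : ℝ)⁻¹ • (S t x - x)) (𝓝[>] 0) (𝓝 y)

/-- `A` generates a C₀ semigroup of contractions on `X`. -/
def GeneratesC0ContractionSemigroup (A : X →ₗ.[ℝ] X) : Prop :=
  ∃ S : ℝ≥0 → X →L[ℝ] X, IsC0ContractionSemigroup S ∧ IsInfinitesimalGenerator A S

end Semigroup

/-! ### Sobolev spaces on a bounded interval -/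

/-- Lebesgue measure on the interval `(a, b)`. -/
noncomputable abbrev volIoo (a b : ℝ) : Measure ℝ := volume.restrict (Ioo a b)

/-- `φ ∈ C_c^∞(a, b)`. -/
structure IsTestFunction (a b : ℝ) (φ : ℝ → ℝ) : Prop where
  contDiff : ContDiff ℝ ∞ φ
  hasCompactSupport : HasCompactSupport φ
  tsupport_subset : tsupport φ ⊆ Ioo a b

/-- `g` is the `k`-th weak derivative of `f` on `(a, b)`. -/
def HasWeakDeriv (a b : ℝ) (k : ℕ) (f g : ℝ → ℝ) : Prop :=
  ∀ φ : ℝ → ℝ, IsTestFunction a b φ →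
    ∫ x in Ioo a b, f x * iteratedDeriv k φ x = (-1) ^ k * ∫ x in Ioo a b, g x * φ x

/-- `f ∈ H^m(a, b)`: `f` and its weak derivatives up to order `m` are in `L²(a, b)`. -/
structure MemSobolev (m : ℕ) (a b : ℝ) (f : ℝ → ℝ) : Prop where
  memLp : MemLp f 2 (volIoo a b)
  exists_weakDeriv : ∀ k ≤ m, ∃ g : ℝ → ℝ, MemLp g 2 (volIoo a b) ∧ HasWeakDeriv a b k f g

open Classical in
/-- The `k`-th weak derivative of `f` on `(a, b)` (a representative of it, well defined up to
almost everywhere equality), if there is one in `L²(a, b)`. -/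
noncomputable def weakDeriv (a b : ℝ) (k : ℕ) (f : ℝ → ℝ) : ℝ → ℝ :=
  if h : ∃ g : ℝ → ℝ, MemLp g 2 (volIoo a b) ∧ HasWeakDeriv a b k f g then h.choose else 0

/-- `f ∈ H^1_0(a, b)`: `f` lies in the closure of `C_c^∞(a, b)` in `H^1(a, b)`. -/
structure MemH10 (a b : ℝ) (f : ℝ → ℝ) : Prop where
  memSobolev : MemSobolev 1 a b f
  exists_approx : ∃ φ : ℕ → ℝ → ℝ, (∀ n, IsTestFunction a b (φ n)) ∧
    Tendsto (fun n => eLpNorm (φ n - f) 2 (volIoo a b)) atTop (𝓝 0) ∧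
    Tendsto (fun n => eLpNorm (deriv (φ n) - weakDeriv a b 1 f) 2 (volIoo a b)) atTop (𝓝 0)

/-- The value at `x ∈ [a, b]` of (the representative continuous on `[a, b]` of) `f` is `c`. -/
def HasTrace (a b : ℝ) (f : ℝ → ℝ) (x c : ℝ) : Prop :=
  ∃ F : ℝ → ℝ, ContinuousOn F (Icc a b) ∧ f =ᵐ[volIoo a b] F ∧ F x = c

section SobolevFacts

variable {a b : ℝ} {k m : ℕ} {f g w : ℝ → ℝ}

theorem IsTestFunction.memLp_iteratedDeriv {φ : ℝ → ℝ} (hφ : IsTestFunction a b φ) (k : ℕ) :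
    MemLp (iteratedDeriv k φ) 2 (volIoo a b) := by
  have hc : Continuous (iteratedDeriv k φ) :=
    hφ.contDiff.continuous_iteratedDeriv k (by exact_mod_cast le_top)
  have hs : HasCompactSupport (iteratedDeriv k φ) := by
    induction k with
    | zero => simpa using hφ.hasCompactSupport
    | succ k ih =>
      rw [iteratedDeriv_succ]
      exact (ih (hφ.contDiff.continuous_iteratedDeriv k (by exact_mod_cast le_top))).deriv
  exact (hc.memLp_of_hasCompactSupport hs (μ := volume)).restrict _

theorem IsTestFunction.memLp {φ : ℝ → ℝ} (hφ : IsTestFunction a b φ) :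
    MemLp φ 2 (volIoo a b) := by
  simpa using hφ.memLp_iteratedDeriv 0

theorem IsTestFunction.lin {φ ψ : ℝ → ℝ} (hφ : IsTestFunction a b φ)
    (hψ : IsTestFunction a b ψ) (s t : ℝ) : IsTestFunction a b (s • φ + t • ψ) := by
  have h1 : tsupport (s • φ) ⊆ tsupport φ := by
    refine closure_mono fun x hx => ?_
    simp only [Function.mem_support, Pi.smul_apply, smul_eq_mul] at hx ⊢
    exact right_ne_zero_of_mul hx
  have h2 : tsupport (t • ψ) ⊆ tsupport ψ := by
    refine closure_mono fun x hx => ?_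
    simp only [Function.mem_support, Pi.smul_apply, smul_eq_mul] at hx ⊢
    exact right_ne_zero_of_mul hx
  have h3 : tsupport (s • φ + t • ψ) ⊆ tsupport φ ∪ tsupport ψ :=
    (tsupport_add _ _).trans (union_subset_union h1 h2)
  refine ⟨(hφ.contDiff.const_smul s).add (hψ.contDiff.const_smul t), ?_, ?_⟩
  · exact (hφ.hasCompactSupport.isCompact.union hψ.hasCompactSupport.isCompact).of_isClosed_subset
      (isClosed_tsupport _) h3
  · exact h3.trans (union_subset hφ.tsupport_subset hψ.tsupport_subset)

theorem HasWeakDeriv.ae_unique {g₁ g₂ : ℝ → ℝ} (h₁ : HasWeakDeriv a b k f g₁)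
    (h₂ : HasWeakDeriv a b k f g₂) (m₁ : MemLp g₁ 2 (volIoo a b))
    (m₂ : MemLp g₂ 2 (volIoo a b)) : g₁ =ᵐ[volIoo a b] g₂ := by
  have hint : IntegrableOn (g₁ - g₂) (Ioo a b) volume := (m₁.sub m₂).integrable (by norm_num)
  have key := isOpen_Ioo.ae_eq_zero_of_integral_contDiff_smul_eq_zero (μ := volume)
    (f := g₁ - g₂) (U := Ioo a b) hint.locallyIntegrableOn (by
      intro φ hφ hc hs
      have hT : IsTestFunction a b φ := ⟨hφ, hc, hs⟩
      have e := (h₁ φ hT).symm.trans (h₂ φ hT)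
      have e' : ∫ x in Ioo a b, g₁ x * φ x = ∫ x in Ioo a b, g₂ x * φ x :=
        mul_left_cancel₀ (pow_ne_zero k (by norm_num)) e
      have i₁ : Integrable (fun x => g₁ x * φ x) (volIoo a b) := m₁.integrable_mul hT.memLp
      have i₂ : Integrable (fun x => g₂ x * φ x) (volIoo a b) := m₂.integrable_mul hT.memLp
      have hz : ∫ x in Ioo a b, (φ x • (g₁ - g₂) x) = 0 := by
        have : (fun x => φ x • (g₁ - g₂) x) = fun x => g₁ x * φ x - g₂ x * φ x := by
          funext x; simp only [Pi.sub_apply, smul_eq_mul]; ring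
        rw [this, integral_sub i₁ i₂, e', sub_self]
      rw [← hz]
      refine (setIntegral_eq_integral_of_forall_compl_eq_zero fun x hx => ?_).symm
      have : φ x = 0 := image_eq_zero_of_notMem_tsupport fun h => hx (hs h)
      simp [this])
  rw [Filter.EventuallyEq, ae_restrict_iff' measurableSet_Ioo]
  filter_upwards [key] with x hx hxU
  exact sub_eq_zero.1 (hx hxU)

theorem HasWeakDeriv.lin {f₁ f₂ g₁ g₂ : ℝ → ℝ} (h₁ : HasWeakDeriv a b k f₁ g₁)
    (h₂ : HasWeakDeriv a b k f₂ g₂) (n₁ : MemLp f₁ 2 (volIoo a b))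
    (n₂ : MemLp f₂ 2 (volIoo a b)) (m₁ : MemLp g₁ 2 (volIoo a b))
    (m₂ : MemLp g₂ 2 (volIoo a b)) (s t : ℝ) (hw : w =ᵐ[volIoo a b] s • f₁ + t • f₂) :
    HasWeakDeriv a b k w (s • g₁ + t • g₂) := by
  intro φ hφ
  have hk := hφ.memLp_iteratedDeriv k
  have e₁ : ∫ x in Ioo a b, w x * iteratedDeriv k φ x
      = ∫ x in Ioo a b, (s * (f₁ x * iteratedDeriv k φ x) + t * (f₂ x * iteratedDeriv k φ x)) := by
    refine integral_congr_ae ?_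
    filter_upwards [hw] with x hx
    rw [hx]; simp only [Pi.add_apply, Pi.smul_apply, smul_eq_mul]; ring
  have e₂ : ∫ x in Ioo a b, (s • g₁ + t • g₂) x * φ x
      = ∫ x in Ioo a b, (s * (g₁ x * φ x) + t * (g₂ x * φ x)) := by
    congr 1; funext x; simp only [Pi.add_apply, Pi.smul_apply, smul_eq_mul]; ring
  have j₁ : Integrable (fun x => f₁ x * iteratedDeriv k φ x) (volIoo a b) := n₁.integrable_mul hk
  have j₂ : Integrable (fun x => f₂ x * iteratedDeriv k φ x) (volIoo a b) := n₂.integrable_mul hk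
  have i₁ : Integrable (fun x => g₁ x * φ x) (volIoo a b) := m₁.integrable_mul hφ.memLp
  have i₂ : Integrable (fun x => g₂ x * φ x) (volIoo a b) := m₂.integrable_mul hφ.memLp
  rw [e₁, e₂, integral_add (j₁.const_mul s) (j₂.const_mul t),
    integral_add (i₁.const_mul s) (i₂.const_mul t)]
  simp only [integral_const_mul]
  rw [h₁ φ hφ, h₂ φ hφ]
  ring

theorem MemSobolev.lin (hf : MemSobolev m a b f) (hg : MemSobolev m a b g) (s t : ℝ)
    (hw : w =ᵐ[volIoo a b] s • f + t • g) : MemSobolev m a b w := by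
  refine ⟨((hf.memLp.const_smul s).add (hg.memLp.const_smul t)).ae_eq hw.symm, fun k hk => ?_⟩
  obtain ⟨f', hf', df⟩ := hf.exists_weakDeriv k hk
  obtain ⟨g', hg', dg⟩ := hg.exists_weakDeriv k hk
  exact ⟨_, (hf'.const_smul s).add (hg'.const_smul t),
    df.lin dg hf.memLp hg.memLp hf' hg' s t hw⟩

theorem memSobolev_zero : MemSobolev m a b 0 :=
  ⟨MemLp.zero, fun k _ => ⟨0, MemLp.zero, fun φ _ => by simp⟩⟩

theorem MemSobolev.weakDeriv_spec (hf : MemSobolev m a b f) (hk : k ≤ m) :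
    MemLp (weakDeriv a b k f) 2 (volIoo a b) ∧ HasWeakDeriv a b k f (weakDeriv a b k f) := by
  have h := hf.exists_weakDeriv k hk
  rw [weakDeriv, dif_pos h]
  exact h.choose_spec

theorem MemSobolev.weakDeriv_lin (hf : MemSobolev m a b f) (hg : MemSobolev m a b g) (hk : k ≤ m)
    (s t : ℝ) (hw : w =ᵐ[volIoo a b] s • f + t • g) :
    weakDeriv a b k w =ᵐ[volIoo a b] s • weakDeriv a b k f + t • weakDeriv a b k g := by
  have F := hf.weakDeriv_spec hk
  have G := hg.weakDeriv_spec hk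
  have W := (hf.lin hg s t hw).weakDeriv_spec hk
  exact W.2.ae_unique (F.2.lin G.2 hf.memLp hg.memLp F.1 G.1 s t hw) W.1
    ((F.1.const_smul s).add (G.1.const_smul t))

theorem weakDeriv_zero_ae : weakDeriv a b k 0 =ᵐ[volIoo a b] 0 := by
  have h := (memSobolev_zero (m := k) (a := a) (b := b)).weakDeriv_lin
    (memSobolev_zero (m := k) (a := a) (b := b)) le_rfl 0 0 (w := 0) (by simp)
  simpa using h

theorem tendsto_eLpNorm_lin {μ : Measure ℝ} {p q r : ℝ → ℝ} {P Q R : ℕ → ℝ → ℝ}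
    {s t : ℝ} (hr : r =ᵐ[μ] s • p + t • q) (hR : ∀ n, R n = s • P n + t • Q n)
    (hP : ∀ n, AEStronglyMeasurable (P n - p) μ) (hQ : ∀ n, AEStronglyMeasurable (Q n - q) μ)
    (lp : Tendsto (fun n => eLpNorm (P n - p) 2 μ) atTop (𝓝 0))
    (lq : Tendsto (fun n => eLpNorm (Q n - q) 2 μ) atTop (𝓝 0)) :
    Tendsto (fun n => eLpNorm (R n - r) 2 μ) atTop (𝓝 0) := by
  have lim : Tendsto (fun n => ‖s‖ₑ * eLpNorm (P n - p) 2 μ + ‖t‖ₑ * eLpNorm (Q n - q) 2 μ)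
      atTop (𝓝 0) := by
    simpa using (ENNReal.Tendsto.const_mul lp (Or.inr enorm_ne_top)).add
      (ENNReal.Tendsto.const_mul lq (Or.inr enorm_ne_top))
  refine tendsto_of_tendsto_of_tendsto_of_le_of_le tendsto_const_nhds lim
    (fun _ => zero_le) fun n => ?_
  have e : R n - r =ᵐ[μ] s • (P n - p) + t • (Q n - q) := by
    filter_upwards [hr] with x hx
    simp only [Pi.sub_apply, hx, hR n, Pi.add_apply, Pi.smul_apply, smul_eq_mul]; ring
  rw [eLpNorm_congr_ae e]
  refine (eLpNorm_add_le ((hP n).const_smul s) ((hQ n).const_smul t) (by norm_num)).trans ?_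
  simp [eLpNorm_const_smul]

theorem MemH10.lin (hf : MemH10 a b f) (hg : MemH10 a b g) (s t : ℝ)
    (hw : w =ᵐ[volIoo a b] s • f + t • g) : MemH10 a b w := by
  refine ⟨hf.memSobolev.lin hg.memSobolev s t hw, ?_⟩
  obtain ⟨φ, hφ, φ0, φ1⟩ := hf.exists_approx
  obtain ⟨ψ, hψ, ψ0, ψ1⟩ := hg.exists_approx
  have F := hf.memSobolev.weakDeriv_spec (k := 1) le_rfl
  have G := hg.memSobolev.weakDeriv_spec (k := 1) le_rfl
  have d : ∀ {θ : ℝ → ℝ}, IsTestFunction a b θ → MemLp (deriv θ) 2 (volIoo a b) := fun hθ => by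
    simpa using hθ.memLp_iteratedDeriv 1
  refine ⟨fun n => s • φ n + t • ψ n, fun n => (hφ n).lin (hψ n) s t, ?_, ?_⟩
  · exact tendsto_eLpNorm_lin hw (fun n => rfl)
      (fun n => ((hφ n).memLp.sub hf.memSobolev.memLp).1)
      (fun n => ((hψ n).memLp.sub hg.memSobolev.memLp).1) φ0 ψ0
  · refine tendsto_eLpNorm_lin
      (hf.memSobolev.weakDeriv_lin hg.memSobolev le_rfl s t hw) (fun n => ?_)
      (fun n => ((d (hφ n)).sub F.1).1) (fun n => ((d (hψ n)).sub G.1).1) φ1 ψ1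
    funext x
    have e₁ := ((hφ n).contDiff.differentiable (by simp)) x
    have e₂ := ((hψ n).contDiff.differentiable (by simp)) x
    rw [deriv_add (e₁.const_smul s) (e₂.const_smul t), deriv_const_smul s e₁,
      deriv_const_smul t e₂]
    rfl

theorem memH10_zero : MemH10 a b 0 := by
  have hz : eLpNorm (0 - weakDeriv a b 1 0) 2 (volIoo a b) = 0 := by
    rw [eLpNorm_congr_ae (g := 0), eLpNorm_zero]
    filter_upwards [weakDeriv_zero_ae (a := a) (b := b) (k := 1)] with x hx
    simp [hx]
  refine ⟨memSobolev_zero, fun _ => 0,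
    fun _ => ⟨contDiff_const, HasCompactSupport.zero, by simp [tsupport]⟩, by simp, ?_⟩
  have hd : deriv (0 : ℝ → ℝ) = 0 := by funext x; simp
  simp only [hd, hz]
  exact tendsto_const_nhds

theorem HasTrace.lin {x c d : ℝ} (hf : HasTrace a b f x c) (hg : HasTrace a b g x d) (s t : ℝ)
    (hw : w =ᵐ[volIoo a b] s • f + t • g) : HasTrace a b w x (s * c + t * d) := by
  obtain ⟨F, cF, eF, rfl⟩ := hf
  obtain ⟨G, cG, eG, rfl⟩ := hg
  refine ⟨s • F + t • G, (cF.const_smul s).add (cG.const_smul t), ?_, by simp⟩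
  filter_upwards [hw, eF, eG] with y h1 h2 h3
  simp [h1, h2, h3]

theorem hasTrace_zero {x : ℝ} (hf : f =ᵐ[volIoo a b] 0) : HasTrace a b f x 0 :=
  ⟨0, continuousOn_const, hf, rfl⟩

end SobolevFacts

/-! ### The linearized Hirota–Satsuma operator with delayed boundary feedback -/

namespace HirotaSatsuma

/-- `L²(a, b)` with the inner product `c ∫ f g`, that is, the `L²` space of `c` times Lebesgue
measure on `(a, b)`. -/
noncomputable abbrev WL2 (c a b : ℝ) : Type := Lp ℝ 2 (ENNReal.ofReal c • volIoo a b)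

/-- `X₀ = L²(0, L) × L²(0, L)` as a Hilbert space. -/
noncomputable abbrev X0 (L : ℝ) : Type :=
  WithLp 2 (Lp ℝ 2 (volIoo 0 L) × Lp ℝ 2 (volIoo 0 L))

/-- `H = X₀ × L²(0, 1)` with the inner product
`⟪(u, v, z), (u', v', z')⟫ = ⟪(u, v), (u', v')⟫_{X₀} + β h ⟪z, z'⟫_{L²(0,1)}`. -/
noncomputable abbrev H (L β h : ℝ) : Type := WithLp 2 (X0 L × WL2 (β * h) 0 1)

theorem inner_eq {L β h : ℝ} (hβ : 0 < β) (hh : 0 < h) (U W : H L β h) :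
    inner ℝ U W = (∫ x in Ioo 0 L, U.fst.fst x * W.fst.fst x)
      + (∫ x in Ioo 0 L, U.fst.snd x * W.fst.snd x)
      + β * h * ∫ ρ in Ioo 0 1, U.snd ρ * W.snd ρ := by
  simp only [WithLp.prod_inner_apply, L2.inner_def, integral_smul_measure,
    ENNReal.toReal_ofReal (mul_pos hβ hh).le, smul_eq_mul, RCLike.inner_apply, conj_trivial, mul_comm (U.fst.fst _), mul_comm (U.fst.snd _),
    mul_comm (U.snd _)]
  rfl

/-- `(u, v, z) ∈ D(A)`. -/
structure InDomain (L α β : ℝ) (u v z : ℝ → ℝ) : Prop where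
  u_H3 : MemSobolev 3 0 L u
  u_H10 : MemH10 0 L u
  v_H3 : MemSobolev 3 0 L v
  v_H10 : MemH10 0 L v
  z_H1 : MemSobolev 1 0 1 z
  /-- `u_x(0) = 0`, `u_x(L) = p = z(0)`, `z(1) = q` and `v_x(L) = α p + β q`. -/
  boundary : ∃ p q : ℝ,
    HasTrace 0 L (weakDeriv 0 L 1 u) 0 0 ∧
    HasTrace 0 L (weakDeriv 0 L 1 u) L p ∧
    HasTrace 0 1 z 0 p ∧
    HasTrace 0 1 z 1 q ∧
    HasTrace 0 L (weakDeriv 0 L 1 v) L (α * p + β * q)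

theorem InDomain.zero {L α β : ℝ} : InDomain L α β 0 0 0 :=
  ⟨memSobolev_zero, memH10_zero, memSobolev_zero, memH10_zero, memSobolev_zero, 0, 0,
    hasTrace_zero weakDeriv_zero_ae, hasTrace_zero weakDeriv_zero_ae,
    hasTrace_zero (ae_eq_refl _), hasTrace_zero (ae_eq_refl _),
    by simpa using hasTrace_zero weakDeriv_zero_ae⟩

theorem InDomain.lin {L α β : ℝ} {u v z u' v' z' u'' v'' z'' : ℝ → ℝ}
    (h : InDomain L α β u v z) (h' : InDomain L α β u' v' z') (s t : ℝ)
    (hu : u'' =ᵐ[volIoo 0 L] s • u + t • u') (hv : v'' =ᵐ[volIoo 0 L] s • v + t • v')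
    (hz : z'' =ᵐ[volIoo 0 1] s • z + t • z') : InDomain L α β u'' v'' z'' := by
  obtain ⟨p, q, h1, h2, h3, h4, h5⟩ := h.boundary
  obtain ⟨p', q', h1', h2', h3', h4', h5'⟩ := h'.boundary
  have du := h.u_H3.weakDeriv_lin h'.u_H3 (k := 1) (by norm_num) s t hu
  have dv := h.v_H3.weakDeriv_lin h'.v_H3 (k := 1) (by norm_num) s t hv
  refine ⟨h.u_H3.lin h'.u_H3 s t hu, h.u_H10.lin h'.u_H10 s t hu, h.v_H3.lin h'.v_H3 s t hv,
    h.v_H10.lin h'.v_H10 s t hv, h.z_H1.lin h'.z_H1 s t hz, s * p + t * p', s * q + t * q',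
    ?_, h2.lin h2' s t du, h3.lin h3' s t hz, h4.lin h4' s t hz, ?_⟩
  · simpa using h1.lin h1' s t du
  · convert h5.lin h5' s t dv using 1
    ring

theorem ae_weighted {c a b : ℝ} (hc : 0 < c) :
    ae (ENNReal.ofReal c • volIoo a b) = ae (volIoo a b) :=
  Measure.ae_ennreal_smul_measure_eq (by simpa using hc) _

theorem coeFn_lin {μ : Measure ℝ} (f g : Lp ℝ 2 μ) (s t : ℝ) :
    ⇑(s • f + t • g) =ᵐ[μ] s • ⇑f + t • ⇑g := by
  filter_upwards [Lp.coeFn_add (s • f) (t • g), Lp.coeFn_smul s f, Lp.coeFn_smul t g]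
    with x h1 h2 h3
  rw [h1, Pi.add_apply, h2, h3, Pi.add_apply]

theorem InDomain.lin_H {L α β h : ℝ} (hβ : 0 < β) (hh : 0 < h) {U W : H L β h}
    (hU : InDomain L α β U.fst.fst U.fst.snd U.snd)
    (hW : InDomain L α β W.fst.fst W.fst.snd W.snd) (s t : ℝ) :
    InDomain L α β (s • U + t • W).fst.fst (s • U + t • W).fst.snd (s • U + t • W).snd :=
  hU.lin hW s t (coeFn_lin _ _ s t) (coeFn_lin _ _ s t)
    (by have := coeFn_lin U.snd W.snd s t
        rwa [Filter.EventuallyEq, ae_weighted (mul_pos hβ hh)] at this)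

/-- `D(A)` as a linear subspace of `H`. -/
def domain (L α β h : ℝ) (hβ : 0 < β) (hh : 0 < h) : Submodule ℝ (H L β h) where
  carrier := {U | InDomain L α β U.fst.fst U.fst.snd U.snd}
  zero_mem' := by
    have hz := Lp.coeFn_zero ℝ 2 (ENNReal.ofReal (β * h) • volIoo 0 1)
    rw [Filter.EventuallyEq, ae_weighted (mul_pos hβ hh)] at hz
    refine InDomain.zero.lin InDomain.zero 0 0 ?_ ?_ ?_
    · rw [zero_smul, add_zero]; exact Lp.coeFn_zero ℝ 2 (volIoo 0 L)
    · rw [zero_smul, add_zero]; exact Lp.coeFn_zero ℝ 2 (volIoo 0 L)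
    · rw [zero_smul, add_zero]; exact hz
  add_mem' {U W} hU hW := by simpa using hU.lin_H hβ hh hW 1 1
  smul_mem' s U hU := by simpa using hU.lin_H hβ hh hU s 0

variable {L α β h : ℝ}

theorem memLp_weighted {c a b : ℝ} {f : ℝ → ℝ} (hf : MemLp f 2 (volIoo a b)) :
    MemLp f 2 (ENNReal.ofReal c • volIoo a b) :=
  hf.smul_measure ENNReal.ofReal_ne_top

/-- The `L²` class of `½ u_xxx`. -/
noncomputable def compU {u v z : ℝ → ℝ} (hU : InDomain L α β u v z) : Lp ℝ 2 (volIoo 0 L) :=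
  ((hU.u_H3.weakDeriv_spec le_rfl).1.const_smul (1 / 2 : ℝ)).toLp
    ((1 / 2 : ℝ) • weakDeriv 0 L 3 u)

/-- The `L²` class of `-v_xxx`. -/
noncomputable def compV {u v z : ℝ → ℝ} (hU : InDomain L α β u v z) : Lp ℝ 2 (volIoo 0 L) :=
  (hU.v_H3.weakDeriv_spec le_rfl).1.neg.toLp (-weakDeriv 0 L 3 v)

/-- The `L²` class of `-(1/h) z_ρ`. -/
noncomputable def compZ (h : ℝ) {u v z : ℝ → ℝ} (hU : InDomain L α β u v z) :
    WL2 (β * h) 0 1 :=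
  (memLp_weighted ((hU.z_H1.weakDeriv_spec le_rfl).1.const_smul (-(1 / h)))).toLp
    ((-(1 / h)) • weakDeriv 0 1 1 z)

/-- `A (u, v, z) = (½ u_xxx, -v_xxx, -(1/h) z_ρ)`, on functions. -/
noncomputable def applyA (h : ℝ) {u v z : ℝ → ℝ} (hU : InDomain L α β u v z) : H L β h :=
  WithLp.toLp 2 (WithLp.toLp 2 (compU hU, compV hU), compZ h hU)

theorem applyA_lin (hβ : 0 < β) (hh : 0 < h) {U W V : H L β h}
    (hU : InDomain L α β U.fst.fst U.fst.snd U.snd)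
    (hW : InDomain L α β W.fst.fst W.fst.snd W.snd) (s t : ℝ)
    (hV : InDomain L α β V.fst.fst V.fst.snd V.snd) (e : V = s • U + t • W) :
    applyA h hV = s • applyA h hU + t • applyA h hW := by
  subst e
  have hz := coeFn_lin U.snd W.snd s t
  rw [Filter.EventuallyEq, ae_weighted (mul_pos hβ hh)] at hz
  have e1 : compU hV = s • compU hU + t • compU hW := by
    refine Lp.ext ?_
    filter_upwards [coeFn_lin (compU hU) (compU hW) s t,
      MemLp.coeFn_toLp ((hU.u_H3.weakDeriv_spec le_rfl).1.const_smul (1 / 2 : ℝ)),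
      MemLp.coeFn_toLp ((hW.u_H3.weakDeriv_spec le_rfl).1.const_smul (1 / 2 : ℝ)),
      MemLp.coeFn_toLp ((hV.u_H3.weakDeriv_spec le_rfl).1.const_smul (1 / 2 : ℝ)),
      hU.u_H3.weakDeriv_lin hW.u_H3 le_rfl s t (coeFn_lin U.fst.fst W.fst.fst s t)]
      with x h1 h2 h3 h4 h5
    rw [h1]
    refine h4.trans ?_
    simp only [Pi.add_apply, Pi.smul_apply, smul_eq_mul] at h5 ⊢
    rw [show compU hU x = _ from h2, show compU hW x = _ from h3]
    simp only [Pi.smul_apply, smul_eq_mul]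
    refine (congrArg (fun y => 1 / 2 * y) h5).trans ?_
    ring
  have e2 : compV hV = s • compV hU + t • compV hW := by
    refine Lp.ext ?_
    filter_upwards [coeFn_lin (compV hU) (compV hW) s t,
      MemLp.coeFn_toLp (hU.v_H3.weakDeriv_spec le_rfl).1.neg,
      MemLp.coeFn_toLp (hW.v_H3.weakDeriv_spec le_rfl).1.neg,
      MemLp.coeFn_toLp (hV.v_H3.weakDeriv_spec le_rfl).1.neg,
      hU.v_H3.weakDeriv_lin hW.v_H3 le_rfl s t (coeFn_lin U.fst.snd W.fst.snd s t)]
      with x h1 h2 h3 h4 h5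
    rw [h1]
    refine h4.trans ?_
    simp only [Pi.add_apply, Pi.smul_apply, smul_eq_mul] at h5 ⊢
    rw [show compV hU x = _ from h2, show compV hW x = _ from h3]
    simp only [Pi.neg_apply]
    refine (congrArg (fun y => -y) h5).trans ?_
    ring
  have e3 : compZ h hV = s • compZ h hU + t • compZ h hW := by
    refine Lp.ext ?_
    have h5' := hU.z_H1.weakDeriv_lin hW.z_H1 le_rfl s t hz
    rw [Filter.EventuallyEq, ← ae_weighted (mul_pos hβ hh)] at h5'
    filter_upwards [coeFn_lin (compZ h hU) (compZ h hW) s t,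
      MemLp.coeFn_toLp (memLp_weighted (c := β * h)
        ((hU.z_H1.weakDeriv_spec le_rfl).1.const_smul (-(1 / h)))),
      MemLp.coeFn_toLp (memLp_weighted (c := β * h)
        ((hW.z_H1.weakDeriv_spec le_rfl).1.const_smul (-(1 / h)))),
      MemLp.coeFn_toLp (memLp_weighted (c := β * h)
        ((hV.z_H1.weakDeriv_spec le_rfl).1.const_smul (-(1 / h)))), h5']
      with x h1 h2 h3 h4 h5
    rw [h1]
    refine h4.trans ?_
    simp only [Pi.add_apply, Pi.smul_apply, smul_eq_mul] at h5 ⊢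
    rw [show compZ h hU x = _ from h2, show compZ h hW x = _ from h3]
    simp only [Pi.smul_apply, smul_eq_mul]
    refine (congrArg (fun y => -(1 / h) * y) h5).trans ?_
    ring
  unfold applyA
  rw [e1, e2, e3]
  rfl

/-- The operator `A (u, v, z) = (½ u_xxx, -v_xxx, -(1/h) z_ρ)` with domain `D(A) ⊆ H`. -/
noncomputable def A (L α β h : ℝ) (hβ : 0 < β) (hh : 0 < h) : H L β h →ₗ.[ℝ] H L β h where
  domain := domain L α β h hβ hh
  toFun :=
    { toFun := fun U => applyA h U.2
      map_add' := fun U W => by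
        simpa using applyA_lin hβ hh U.2 W.2 1 1 (U + W).2 (by simp)
      map_smul' := fun s U => by
        simpa using applyA_lin hβ hh U.2 U.2 s 0 (s • U).2 (by simp) }

end HirotaSatsuma

/-!
On a real Hilbert space a dissipative operator `A` that is onto generates a contraction semigroup,
and the Hirota-Satsuma operator is both.

**Abstract part.** A linear right inverse `T` of `A` is everywhere defined and dissipative, hence
bounded by the closed graph theorem (`LinearMap.continuous_of_inner_self_nonpos`). By Lax-Milgram
`T - c` is invertible for every `c > 0`, and `B_c = (T - c)⁻¹` is exactly the Yosida approximation
of `A`: it is bounded and dissipative, the `B_c` commute, and `B_c x → A x` on the domain as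
`c → 0` (`exists_bounded_dissipative_approx`). The exponentials `exp (t B_c)` are contractions with
`‖exp (t B_c) x - exp (t B_d) x‖ ≤ t ‖B_c x - B_d x‖`, so they converge strongly to a semigroup. A
Taylor estimate uniform in `c` shows that its generator extends `A`; the generator being
dissipative and `1 - A` being onto, the two coincide (`generatesC0ContractionSemigroup`).

**Sobolev spaces on an interval.** By the du Bois-Reymond lemma a function with weak derivative in
`L²` agrees almost everywhere with a primitive (`HasWeakDeriv.exists_isPrimitive`), for which
integration by parts is available. Such a function is in `H¹₀` exactly when both of its boundary
values vanish (`MemH10.eq_zero_of_isPrimitive`, `IsPrimitive.memH10`); the harder direction uses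
that the derivatives of test functions are dense in the functions of mean zero, their orthogonal
complement being the constants.

**The operator.** With `p = u_x(L)` and `q = z(1)`, integration by parts gives
`⟪A U, U⟫ = -p² / 4 + (α p + β q)² / 2 - v_x(0)² / 2 - β (q² - p²) / 2`, which is nonpositive under
the smallness condition (`HirotaSatsuma.A_inner_self_nonpos`). Surjectivity
(`HirotaSatsuma.A_surjective`) is solved explicitly: integrate the `u` equation three times, which
determines `p`, then the transport equation with `z(0) = p`, which determines `q`, and finally the
`v` equation with `v_x(L) = α p + β q`.
-/

/-! ### Exponentials of bounded dissipative operators -/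

section DissipativeExponential

open NormedSpace

variable {X : Type*} [NormedAddCommGroup X] [InnerProductSpace ℝ X]

theorem exp_smul_apply_comm (B : X →L[ℝ] X) (x : X) (t : ℝ) :
    exp (t • B) (B x) = B (exp (t • B) x) := by
  have h : Commute (exp (t • B)) B := ((Commute.refl B).smul_left t).exp_left
  exact congrArg (fun C : X →L[ℝ] X => C x) h.eq

variable [CompleteSpace X]

/-- An everywhere defined dissipative operator is bounded: dissipativity forces its graph to be
closed. -/
theorem LinearMap.continuous_of_inner_self_nonpos (T : X →ₗ[ℝ] X)
    (hT : ∀ x, inner ℝ (T x) x ≤ 0) : Continuous T := by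
  refine T.continuous_of_seq_closed_graph fun u x y hu hTu => ?_
  have key : ∀ w, 0 ≤ inner ℝ (y - T x) w := by
    intro w
    have h1 : ∀ s : ℝ, 0 < s → 0 ≤ inner ℝ (y - T x - s • T w) w := by
      intro s hs
      have h2 : ∀ n, inner ℝ (T (u n) - T x - s • T w) (u n - x - s • w) ≤ 0 := fun n => by
        simpa using hT (u n - x - s • w)
      have h3 : Tendsto (fun n => inner ℝ (T (u n) - T x - s • T w) (u n - x - s • w)) atTop
          (𝓝 (inner ℝ (y - T x - s • T w) (x - x - s • w))) :=
        ((hTu.sub_const _).sub_const _).inner ((hu.sub_const _).sub_const _)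
      have h4 := le_of_tendsto' h3 h2
      rw [sub_self, zero_sub, inner_neg_right, inner_smul_right] at h4
      nlinarith
    have h5 : Tendsto (fun s : ℝ => inner ℝ (y - T x - s • T w) w) (𝓝[>] 0)
        (𝓝 (inner ℝ (y - T x - (0 : ℝ) • T w) w)) := by
      refine Tendsto.mono_left ?_ nhdsWithin_le_nhds
      exact Continuous.tendsto (by fun_prop) 0
    rw [zero_smul, sub_zero] at h5
    exact ge_of_tendsto h5 (eventually_mem_nhdsWithin.mono fun s hs => h1 s hs)
  -- Testing with `-(y - T x)` shows that `y - T x` vanishes.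
  have h6 := key (-(y - T x))
  rw [inner_neg_right] at h6
  rw [real_inner_self_eq_norm_sq] at h6
  exact sub_eq_zero.1 (norm_eq_zero.1 (pow_eq_zero_iff two_ne_zero |>.1
    (le_antisymm (by linarith) (sq_nonneg _))))

theorem hasDerivAt_exp_smul_apply (B : X →L[ℝ] X) (x : X) (t : ℝ) :
    HasDerivAt (fun s : ℝ => exp (s • B) x) (exp (t • B) (B x)) t :=
  ((ContinuousLinearMap.apply ℝ X x).hasFDerivAt.comp_hasDerivAt t
    (hasDerivAt_exp_smul_const (𝕂 := ℝ) B t))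

theorem norm_exp_smul_apply_le {B : X →L[ℝ] X} (hB : ∀ x, inner ℝ (B x) x ≤ 0) {t : ℝ}
    (ht : 0 ≤ t) (x : X) : ‖exp (t • B) x‖ ≤ ‖x‖ := by
  have hd : ∀ s : ℝ, HasDerivAt (fun s : ℝ => ‖exp (s • B) x‖ ^ 2)
      (2 * inner ℝ (exp (s • B) x) (B (exp (s • B) x))) s := fun s => by
    simpa only [exp_smul_apply_comm] using (hasDerivAt_exp_smul_apply B x s).norm_sq
  have hanti : Antitone (fun s : ℝ => ‖exp (s • B) x‖ ^ 2) :=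
    antitone_of_deriv_nonpos (fun s => (hd s).differentiableAt) fun s => by
      rw [(hd s).deriv, real_inner_comm]
      linarith [hB (exp (s • B) x)]
  have := hanti ht
  simp only [zero_smul, exp_zero, one_apply_eq_self] at this
  exact (pow_le_pow_iff_left₀ (norm_nonneg _) (norm_nonneg _) two_ne_zero).1 this

/-- The path `s ↦ exp (s B) exp ((t - s) C) x` joins the two exponentials with speed at most
`‖B x - C x‖`. -/
theorem norm_exp_smul_sub_exp_smul_le {B C : X →L[ℝ] X} (hB : ∀ x, inner ℝ (B x) x ≤ 0)
    (hC : ∀ x, inner ℝ (C x) x ≤ 0) (hBC : Commute B C) {t : ℝ} (ht : 0 ≤ t) (x : X) :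
    ‖exp (t • B) x - exp (t • C) x‖ ≤ ‖B x - C x‖ * t := by
  let : NormedAlgebra ℚ (X →L[ℝ] X) := NormedAlgebra.restrictScalars ℚ ℝ _
  have hsplit : ∀ s y, exp (s • (B - C)) (exp (t • C) y)
      = exp (s • B) (exp ((t - s) • C) y) := fun s y => by
    have h1 : exp (s • (B - C)) * exp (t • C) = exp (s • B) * exp ((t - s) • C) := by
      rw [← exp_add_of_commute, ← exp_add_of_commute]
      · congr 1
        rw [smul_sub, sub_smul]; abel
      · exact (hBC.smul_left _).smul_right _
      · exact ((hBC.sub_left (Commute.refl C)).smul_left _).smul_right _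
    exact congrArg (fun D : X →L[ℝ] X => D y) h1
  have hd : ∀ s : ℝ, HasDerivAt (fun s : ℝ => exp (s • (B - C)) (exp (t • C) x))
      (exp (s • B) (exp ((t - s) • C) (B x - C x))) s := fun s => by
    convert hasDerivAt_exp_smul_apply (B - C) (exp (t • C) x) s using 1
    rw [← hsplit]
    congr 1
    have h : Commute (exp (t • C)) (B - C) :=
      ((hBC.symm.sub_right (Commute.refl C)).smul_left t).exp_left
    exact congrArg (fun D : X →L[ℝ] X => D x) h.eq
  have key := norm_image_sub_le_of_norm_deriv_le_segment' (a := 0) (b := t)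
    (f := fun s : ℝ => exp (s • (B - C)) (exp (t • C) x)) (C := ‖B x - C x‖)
    (fun s _ => (hd s).hasDerivWithinAt)
    (fun s hs => (norm_exp_smul_apply_le hB hs.1 _).trans
      (norm_exp_smul_apply_le hC (sub_nonneg.2 hs.2.le) _)) t ⟨ht, le_rfl⟩
  simpa [hsplit] using key

theorem norm_exp_smul_sub_self_le {B : X →L[ℝ] X} (hB : ∀ x, inner ℝ (B x) x ≤ 0) {t : ℝ}
    (ht : 0 ≤ t) (x : X) : ‖exp (t • B) x - x‖ ≤ ‖B x‖ * t := by
  simpa using norm_exp_smul_sub_exp_smul_le hB (C := 0) (by simp) (Commute.zero_right B) ht x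

/-- First-order Taylor estimate for the exponential, uniform in the norm of the operator `B`:
the remainder is `o(t)` once `B x` is approximated by vectors `y` for which `B y` is bounded. -/
theorem norm_exp_smul_sub_sub_le {B : X →L[ℝ] X} (hB : ∀ x, inner ℝ (B x) x ≤ 0) {t : ℝ}
    (ht : 0 ≤ t) (x y : X) :
    ‖exp (t • B) x - x - t • B x‖ ≤ (2 * ‖B x - y‖ + ‖B y‖ * t) * t := by
  have hd : ∀ s : ℝ, HasDerivAt (fun s : ℝ => exp (s • B) x - s • B x)
      (exp (s • B) (B x) - B x) s := fun s => by
    simpa using! (hasDerivAt_exp_smul_apply B x s).sub ((hasDerivAt_id s).smul_const (B x))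
  have key := norm_image_sub_le_of_norm_deriv_le_segment' (a := 0) (b := t)
    (f := fun s : ℝ => exp (s • B) x - s • B x) (C := 2 * ‖B x - y‖ + ‖B y‖ * t)
    (fun s _ => (hd s).hasDerivWithinAt) (fun s hs => by
      -- Replace `B x` by `y`, on which `exp (s • B)` moves with speed at most `‖B y‖`.
      have e : exp (s • B) (B x) - B x
          = exp (s • B) (B x - y) - (B x - y) + (exp (s • B) y - y) := by
        rw [map_sub]; abel
      have h1 := norm_exp_smul_apply_le hB hs.1 (B x - y)
      have h2 := norm_exp_smul_sub_self_le hB hs.1 y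
      have h3 : ‖B y‖ * s ≤ ‖B y‖ * t := by gcongr; exact hs.2.le
      rw [e]
      have h4 := norm_add_le (exp (s • B) (B x - y) - (B x - y)) (exp (s • B) y - y)
      have h5 := norm_sub_le (exp (s • B) (B x - y)) (B x - y)
      linarith) t ⟨ht, le_rfl⟩
  convert key using 2
  · simp only [zero_smul, exp_zero, one_apply_eq_self, sub_zero]; abel
  · rw [sub_zero]

end DissipativeExponential

/-! ### Generation of contraction semigroups -/

section Generation

open NormedSpace

variable {X : Type*} [NormedAddCommGroup X] [InnerProductSpace ℝ X] [CompleteSpace X]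

/-- Lax-Milgram for `c - T`, which is coercive with constant `c`. -/
theorem ContinuousLinearMap.isUnit_sub_smul_one {T : X →L[ℝ] X} (hT : ∀ x, inner ℝ (T x) x ≤ 0)
    {c : ℝ} (hc : 0 < c) : IsUnit (T - c • (1 : X →L[ℝ] X)) := by
  let R : X →L[ℝ] X := c • (1 : X →L[ℝ] X) - T
  have hco : IsCoercive ((innerSL ℝ).comp R) := by
    refine ⟨c, hc, fun x => ?_⟩
    have : inner ℝ (R x) x = c * (‖x‖ * ‖x‖) - inner ℝ (T x) x := by
      simp [R, inner_sub_left, inner_smul_left, sq]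
    change _ ≤ inner ℝ (R x) x
    linarith [hT x]
  have he : (hco.continuousLinearEquivOfBilin : X →L[ℝ] X) = R := by
    ext x
    refine ext_inner_right ℝ fun w => ?_
    exact hco.continuousLinearEquivOfBilin_apply x w
  have hu : IsUnit R := by
    rw [← he]
    exact ⟨ContinuousLinearEquiv.toUnit hco.continuousLinearEquivOfBilin, rfl⟩
  simpa [R] using hu.neg

/-- A dissipative operator `A` that is onto has dense domain, `1 - A` is onto as well, and `A` is a
pointwise limit of commuting bounded dissipative operators. These are the Yosida approximations
`(T - c)⁻¹`, where `T` is the inverse of `A` and `c ↓ 0`. -/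
theorem exists_bounded_dissipative_approx (A : X →ₗ.[ℝ] X)
    (hA : ∀ x : A.domain, inner ℝ (A x) (x : X) ≤ 0) (hsurj : ∀ f, ∃ x : A.domain, A x = f) :
    (∀ f, ∃ x : A.domain, (x : X) - A x = f) ∧ Dense (A.domain : Set X) ∧ ∃ B : ℕ → X →L[ℝ] X, (∀ n x, inner ℝ (B n x) x ≤ 0) ∧
      (∀ m n, Commute (B m) (B n)) ∧
      ∀ x : A.domain, Tendsto (fun n => B n x) atTop (𝓝 (A x)) := by
  -- A linear right inverse exists by algebra alone; it is bounded because it is dissipative.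
  obtain ⟨R, hR⟩ := A.toFun.exists_rightInverse_of_surjective
    (LinearMap.range_eq_top.2 hsurj)
  have hAR : ∀ f, A (R f) = f := fun f => congrArg (fun g : X →ₗ[ℝ] X => g f) hR
  let T₀ : X →ₗ[ℝ] X := A.domain.subtype ∘ₗ R
  have hT₀ : ∀ f, inner ℝ (T₀ f) f ≤ 0 := fun f => by
    have := hA (R f)
    rwa [hAR, real_inner_comm] at this
  let T : X →L[ℝ] X := ⟨T₀, T₀.continuous_of_inner_self_nonpos hT₀⟩
  have hT : ∀ f, inner ℝ (T f) f ≤ 0 := hT₀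
  have hT_mem : ∀ f, T f ∈ A.domain := fun f => (R f).2
  -- Dissipativity and surjectivity make `A` injective, so that `T` is a two-sided inverse.
  have hinj : ∀ x : A.domain, A x = 0 → (x : X) = 0 := by
    intro x hx
    obtain ⟨w, hw⟩ := hsurj x
    have h1 : ∀ s : ℝ, 0 < s → ‖(x : X)‖ ^ 2 + s * inner ℝ (x : X) (w : X) ≤ 0 := by
      intro s hs
      have h2 := hA (x + s • w)
      rw [LinearPMap.map_add, LinearPMap.map_smul, hx, hw, zero_add, Submodule.coe_add,
        Submodule.coe_smul, inner_add_right, inner_smul_left, inner_smul_right, inner_smul_left,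
        real_inner_self_eq_norm_sq, conj_trivial] at h2
      nlinarith
    have h3 : Tendsto (fun s : ℝ => ‖(x : X)‖ ^ 2 + s * inner ℝ (x : X) (w : X)) (𝓝[>] 0)
        (𝓝 (‖(x : X)‖ ^ 2 + 0 * inner ℝ (x : X) (w : X))) :=
      (Continuous.tendsto (by fun_prop) 0).mono_left nhdsWithin_le_nhds
    rw [zero_mul, add_zero] at h3
    have h4 := le_of_tendsto h3 (eventually_mem_nhdsWithin.mono fun s hs => h1 s hs)
    exact norm_eq_zero.1 (pow_eq_zero_iff two_ne_zero |>.1 (le_antisymm h4 (sq_nonneg _)))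
  have hTA : ∀ x : A.domain, T (A x) = x := fun x => by
    have := hinj (R (A x) - x) (by rw [LinearPMap.map_sub, hAR, sub_self])
    exact sub_eq_zero.1 this
  have hone : ∀ f, ∃ x : A.domain, (x : X) - A x = f := fun f => by
    obtain ⟨V, hV⟩ := ContinuousLinearMap.isUnit_sub_smul_one hT one_pos
    let C : X →L[ℝ] X := (V⁻¹ : (X →L[ℝ] X)ˣ)
    have h1 : (V : X →L[ℝ] X) (C f) = f := congrArg (fun D : X →L[ℝ] X => D f) V.mul_inv
    rw [hV] at h1
    refine ⟨R (C f), ?_⟩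
    rw [hAR]
    simpa using! h1
  have hdense : Dense (A.domain : Set X) := by
    rw [Submodule.dense_iff_topologicalClosure_eq_top, Submodule.topologicalClosure_eq_top_iff,
      Submodule.eq_bot_iff]
    intro f hf
    obtain ⟨x, hx⟩ := hone f
    have h1 : inner ℝ (x : X) f = 0 := (Submodule.mem_orthogonal _ _).1 hf _ x.2
    rw [← hx, inner_sub_right, real_inner_self_eq_norm_sq, real_inner_comm] at h1
    have h2 : (x : X) = 0 :=
      norm_eq_zero.1 (pow_eq_zero_iff two_ne_zero |>.1
        (le_antisymm (by linarith [hA x]) (sq_nonneg _)))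
    have h3 : x = 0 := Subtype.ext h2
    rw [← hx, h2, h3, LinearPMap.map_zero, sub_zero]
  refine ⟨hone, hdense, ?_⟩
  let c : ℕ → ℝ := fun n => 1 / ((n : ℝ) + 1)
  have hc : ∀ n, 0 < c n := fun n => by positivity
  have hc0 : Tendsto c atTop (𝓝 0) := tendsto_one_div_add_atTop_nhds_zero_nat
  choose V hV using fun n => ContinuousLinearMap.isUnit_sub_smul_one hT (hc n)
  let B : ℕ → X →L[ℝ] X := fun n => ((V n)⁻¹ : (X →L[ℝ] X)ˣ)
  have hB1 : ∀ n f, T (B n f) - c n • B n f = f := fun n f => by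
    have := congrArg (fun C : X →L[ℝ] X => C f) (V n).mul_inv
    rw [hV] at this
    simpa using this
  -- `hB1` and `hB2` say that `B n` is a right and a left inverse of `T - c n`.
  have hB2 : ∀ n f, B n (T f) = f + c n • B n f := fun n f => by
    have := congrArg (fun C : X →L[ℝ] X => C f) (V n).inv_mul
    rw [hV] at this
    have h' : B n (T f - c n • f) = f := by simpa using this
    rw [map_sub, map_smul] at h'
    exact sub_eq_iff_eq_add.1 h'
  have hB3 : ∀ n f, c n * ‖B n f‖ ^ 2 ≤ - inner ℝ (B n f) f := fun n f => by
    have h1 := hT (B n f)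
    have h2 : inner ℝ (T (B n f)) (B n f) = inner ℝ (f + c n • B n f) (B n f) := by
      rw [← sub_eq_iff_eq_add.1 (hB1 n f)]
    rw [h2, inner_add_left, inner_smul_left, real_inner_self_eq_norm_sq, conj_trivial,
      real_inner_comm] at h1
    linarith
  have hB4 : ∀ n f, ‖c n • B n f‖ ≤ ‖f‖ := fun n f => by
    rw [norm_smul, Real.norm_of_nonneg (hc n).le]
    have h1 : - inner ℝ (B n f) f ≤ ‖B n f‖ * ‖f‖ :=
      (neg_le_abs _).trans (abs_real_inner_le_norm _ _)
    rcases (norm_nonneg (B n f)).eq_or_lt with h0 | h0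
    · rw [← h0, mul_zero]; exact norm_nonneg f
    · have := (hB3 n f).trans h1
      nlinarith
  refine ⟨B, fun n f => ?_, fun m n => ?_, fun x => ?_⟩
  · linarith [hB3 n f, mul_nonneg (hc n).le (sq_nonneg ‖B n f‖)]
  · have h : Commute (V m : X →L[ℝ] X) (V n) := by
      rw [hV, hV]
      exact ((Commute.refl T).sub_left ((Commute.one_left T).smul_left _)).sub_right
        ((Commute.one_right _).smul_right _)
    exact h.units_inv_left.units_inv_right
  · have h1 : ∀ n, B n x = A x + c n • B n (A x) := fun n => by rw [← hB2, hTA]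
    simp only [h1]
    suffices h : Tendsto (fun n => c n • B n (A x)) atTop (𝓝 0) by
      simpa using tendsto_const_nhds.add h
    rw [Metric.tendsto_atTop]
    intro ε hε
    obtain ⟨w, hw, hwε⟩ := Metric.dense_iff.1 hdense (A x) (ε / 2) (half_pos hε)
    lift w to A.domain using hwε
    have h2 : Tendsto (fun n => c n * (2 * ‖A w‖)) atTop (𝓝 0) := by
      simpa using hc0.mul_const (2 * ‖A w‖)
    obtain ⟨N, hN⟩ := (h2.eventually (gt_mem_nhds (half_pos hε))).exists_forall_of_atTop
    refine ⟨N, fun n hn => ?_⟩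
    rw [dist_zero_right]
    have e : c n • B n (A x) = c n • B n (A x - w) + c n • (A w + c n • B n (A w)) := by
      rw [← hB2, hTA, ← smul_add, ← map_add, sub_add_cancel]
    have h5 : ‖c n • (A w + c n • B n (A w))‖ ≤ c n * (2 * ‖A w‖) := by
      rw [norm_smul, Real.norm_of_nonneg (hc n).le]
      have := norm_add_le (A w) (c n • B n (A w))
      exact mul_le_mul_of_nonneg_left (by linarith [hB4 n (A w)]) (hc n).le
    have h6 : ‖A x - w‖ < ε / 2 := by
      rw [← dist_eq_norm, dist_comm]; exact hw
    rw [e]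
    linarith [norm_add_le (c n • B n (A x - w)) (c n • (A w + c n • B n (A w))),
      hB4 n (A x - w), hN n hn]

/-- A form of the Lumer-Phillips theorem: in a real Hilbert space, a dissipative operator that is
onto generates a contraction semigroup, the strong limit of the exponentials of its Yosida
approximations. -/
theorem generatesC0ContractionSemigroup (A : X →ₗ.[ℝ] X)
    (hA : ∀ x : A.domain, inner ℝ (A x) (x : X) ≤ 0) (hsurj : ∀ f, ∃ x : A.domain, A x = f) :
    GeneratesC0ContractionSemigroup A := by
  obtain ⟨hone, hdense, B, hB, hcomm, hlim⟩ := exists_bounded_dissipative_approx A hA hsurj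
  have hcontr : ∀ (t : ℝ≥0) n x, ‖exp ((t : ℝ) • B n) x‖ ≤ ‖x‖ := fun t n x =>
    norm_exp_smul_apply_le (hB n) t.2 x
  have hconv : ∀ (t : ℝ≥0) x, ∃ y, Tendsto (fun n => exp ((t : ℝ) • B n) x) atTop (𝓝 y) := by
    intro t x
    refine cauchySeq_tendsto_of_complete (Metric.cauchySeq_iff'.2 fun ε hε => ?_)
    obtain ⟨w, hw, hwD⟩ := Metric.dense_iff.1 hdense x (ε / 4) (by positivity)
    lift w to A.domain using hwD
    have hδ : 0 < ε / 4 / ((t : ℝ) + 1) := by positivity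
    obtain ⟨N, hN⟩ := Metric.cauchySeq_iff'.1 (hlim w).cauchySeq _ hδ
    refine ⟨N, fun n hn => ?_⟩
    rw [dist_eq_norm]
    have h1 := norm_exp_smul_sub_exp_smul_le (hB n) (hB N) (hcomm n N) t.2 (w : X)
    have h2 : ‖B n w - B N w‖ * t ≤ ε / 4 := by
      rw [← dist_eq_norm]
      have h3 := (lt_div_iff₀ (by positivity)).1 (hN n hn)
      have : 0 ≤ dist (B n w) (B N w) := dist_nonneg
      nlinarith
    have h4 : ‖x - w‖ < ε / 4 := by rw [← dist_eq_norm, dist_comm]; exact hw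
    have e : exp ((t : ℝ) • B n) x - exp ((t : ℝ) • B N) x = exp ((t : ℝ) • B n) (x - w)
        + (exp ((t : ℝ) • B n) (w : X) - exp ((t : ℝ) • B N) (w : X))
        - exp ((t : ℝ) • B N) (x - w) := by
      rw [map_sub, map_sub]; abel
    rw [e]
    have h5 := norm_sub_le (exp ((t : ℝ) • B n) (x - w)
        + (exp ((t : ℝ) • B n) (w : X) - exp ((t : ℝ) • B N) (w : X)))
        (exp ((t : ℝ) • B N) (x - w))
    have h6 := norm_add_le (exp ((t : ℝ) • B n) (x - w))
        (exp ((t : ℝ) • B n) (w : X) - exp ((t : ℝ) • B N) (w : X))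
    have h7 := hcontr t n (x - w)
    have h8 := hcontr t N (x - w)
    simp only [NNReal.val_eq_coe] at h1
    linarith
  choose S₀ hS₀ using hconv
  let S : ℝ≥0 → X →L[ℝ] X := fun t =>
    continuousLinearMapOfTendsto (fun n => exp ((t : ℝ) • B n)) (tendsto_pi_nhds.2 (hS₀ t))
  have hS : ∀ (t : ℝ≥0) x, Tendsto (fun n => exp ((t : ℝ) • B n) x) atTop (𝓝 (S t x)) := hS₀
  have hSle : ∀ t x, ‖S t x‖ ≤ ‖x‖ := fun t x =>
    le_of_tendsto' (hS t x).norm fun n => hcontr t n x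
  have hSD : ∀ (t : ℝ≥0) (x : A.domain), ‖S t x - (x : X)‖ ≤ ‖A x‖ * (t : ℝ) := fun t x =>
    le_of_tendsto_of_tendsto' ((hS t x).sub_const _).norm ((hlim x).norm.mul_const _)
      fun n => norm_exp_smul_sub_self_le (hB n) t.2 x
  have htaylor : ∀ (t : ℝ≥0) (x y : A.domain),
      ‖S t x - (x : X) - (t : ℝ) • A x‖ ≤ (2 * ‖A x - y‖ + ‖A y‖ * t) * t := fun t x y =>
    le_of_tendsto_of_tendsto' (((hS t x).sub_const _).sub ((hlim x).const_smul _)).norm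
      (((((hlim x).sub_const _).norm.const_mul 2).add ((hlim y).norm.mul_const _)).mul_const _)
      fun n => norm_exp_smul_sub_sub_le (hB n) t.2 x y
  have hcoe : Tendsto (fun t : ℝ≥0 => (t : ℝ)) (𝓝[>] 0) (𝓝 0) :=
    (NNReal.continuous_coe.tendsto 0).mono_left nhdsWithin_le_nhds
  have hgen : ∀ x : A.domain,
      Tendsto (fun t : ℝ≥0 => (t : ℝ)⁻¹ • (S t x - x)) (𝓝[>] 0) (𝓝 (A x)) := by
    intro x
    rw [Metric.tendsto_nhds]
    intro ε hε
    obtain ⟨w, hw, hwD⟩ := Metric.dense_iff.1 hdense (A x) (ε / 4) (by positivity)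
    lift w to A.domain using hwD
    have h1 : Tendsto (fun t : ℝ≥0 => ‖A w‖ * (t : ℝ)) (𝓝[>] 0) (𝓝 0) := by
      simpa using hcoe.const_mul ‖A w‖
    filter_upwards [h1.eventually (gt_mem_nhds (half_pos hε)), self_mem_nhdsWithin] with t ht ht0
    have ht0' : 0 < (t : ℝ) := NNReal.coe_pos.2 ht0
    have e : (t : ℝ)⁻¹ • (S t x - x) - A x = (t : ℝ)⁻¹ • (S t x - x - (t : ℝ) • A x) := by
      rw [smul_sub _ (S t x - x), inv_smul_smul₀ ht0'.ne']
    have h4 : ‖A x - w‖ < ε / 4 := by rw [← dist_eq_norm, dist_comm]; exact hw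
    rw [dist_eq_norm, e, norm_smul, norm_inv, Real.norm_of_nonneg ht0'.le, inv_mul_lt_iff₀ ht0',
      mul_comm]
    refine (htaylor t x w).trans_lt ?_
    gcongr
    linarith
  refine ⟨S, ⟨⟨?_, fun s t => ?_, fun x => ?_⟩, fun t => ?_⟩, fun x y => ⟨?_, fun hxy => ?_⟩⟩
  · ext x
    refine tendsto_nhds_unique (hS 0 x) ?_
    simp
  · let : NormedAlgebra ℚ (X →L[ℝ] X) := NormedAlgebra.restrictScalars ℚ ℝ _
    ext x
    refine tendsto_nhds_unique (hS (s + t) x) ?_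
    have h1 : ∀ n, exp (((s + t : ℝ≥0) : ℝ) • B n) x
        = exp ((s : ℝ) • B n) (exp ((t : ℝ) • B n) x - S t x) + exp ((s : ℝ) • B n) (S t x) := by
      intro n
      rw [← map_add, sub_add_cancel, NNReal.coe_add, add_smul, exp_add_of_commute
        (((Commute.refl _).smul_left _).smul_right _)]
      rfl
    simp only [h1]
    have h2 : Tendsto (fun n => exp ((s : ℝ) • B n) (exp ((t : ℝ) • B n) x - S t x)) atTop
        (𝓝 0) :=
      squeeze_zero_norm (fun n => hcontr s n _) (by simpa using ((hS t x).sub_const (S t x)).norm)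
    simpa using h2.add (hS s (S t x))
  · rw [Metric.tendsto_nhds]
    intro ε hε
    obtain ⟨w, hw, hwD⟩ := Metric.dense_iff.1 hdense x (ε / 4) (by positivity)
    lift w to A.domain using hwD
    have h1 : Tendsto (fun t : ℝ≥0 => ‖A w‖ * (t : ℝ)) (𝓝[>] 0) (𝓝 0) := by
      simpa using hcoe.const_mul ‖A w‖
    filter_upwards [h1.eventually (gt_mem_nhds (half_pos hε))] with t ht
    have h4 : ‖x - w‖ < ε / 4 := by rw [← dist_eq_norm, dist_comm]; exact hw
    have e : S t x - x = S t (x - w) - (x - w) + (S t w - w) := by rw [map_sub]; abel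
    rw [dist_eq_norm, e]
    linarith [norm_add_le (S t (x - w) - (x - w)) (S t (w : X) - w),
      norm_sub_le (S t (x - w)) (x - w), hSle t (x - w), hSD t w]
  · exact ContinuousLinearMap.opNorm_le_bound _ zero_le_one fun x => by simpa using hSle t x
  · intro hxy
    obtain ⟨w, rfl, rfl⟩ := (LinearPMap.mem_graph_iff A).1 hxy
    exact hgen w
  · -- The generator extends `A` and is dissipative, while `1 - A` is already onto.
    obtain ⟨w, hw⟩ := hone (x - y)
    have h1 : Tendsto (fun t : ℝ≥0 => (t : ℝ)⁻¹ • (S t (x - w) - (x - w))) (𝓝[>] 0)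
        (𝓝 (y - A w)) := by
      refine (hxy.sub (hgen w)).congr fun t => ?_
      rw [map_sub, ← smul_sub]
      congr 1; abel
    have h2 : y - A w = x - w := by
      have := congrArg (fun v => v + y - w) hw
      simp only [sub_add_cancel] at this
      rw [← this]; abel
    rw [h2] at h1
    have h3 : ∀ t : ℝ≥0, inner ℝ ((t : ℝ)⁻¹ • (S t (x - w) - (x - w))) (x - w) ≤ 0 := fun t => by
      rw [inner_smul_left, inner_sub_left, real_inner_self_eq_norm_mul_norm, conj_trivial]
      have h4 := real_inner_le_norm (S t (x - w)) (x - w)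
      have h5 := mul_le_mul_of_nonneg_right (hSle t (x - w)) (norm_nonneg (x - w))
      exact mul_nonpos_of_nonneg_of_nonpos (by positivity) (by linarith)
    have h4 := le_of_tendsto' (h1.inner tendsto_const_nhds) h3
    rw [real_inner_self_eq_norm_sq] at h4
    have h5 : x - w = 0 :=
      norm_eq_zero.1 (pow_eq_zero_iff two_ne_zero |>.1 (le_antisymm h4 (sq_nonneg _)))
    rw [h5] at h2
    exact (LinearPMap.mem_graph_iff A).2 ⟨w, (sub_eq_zero.1 h5).symm, (sub_eq_zero.1 h2).symm⟩

end Generation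

/-! ### Primitives of square integrable functions -/

section Primitives

variable {a b : ℝ} {F G f g : ℝ → ℝ}

/-- `F` is absolutely continuous on `[a, b]` with derivative `f ∈ L²(a, b)`, expressed through the
fundamental theorem of calculus. -/
structure IsPrimitive (a b : ℝ) (F f : ℝ → ℝ) : Prop where
  memLp : MemLp f 2 (volIoo a b)
  eq_add_integral : ∀ x ∈ Icc a b, F x = F a + ∫ t in a..x, f t

theorem MeasureTheory.MemLp.intervalIntegrable_of_volIoo (hab : a ≤ b)
    (hf : MemLp f 2 (volIoo a b)) : IntervalIntegrable f volume a b :=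
  (intervalIntegrable_iff_integrableOn_Ioo_of_le hab).2 (hf.integrable (by norm_num))

theorem ContinuousOn.memLp_volIoo (hF : ContinuousOn F (Icc a b)) : MemLp F 2 (volIoo a b) := by
  obtain ⟨C, hC⟩ := isCompact_Icc.exists_bound_of_continuousOn hF
  refine MemLp.of_bound
    ((hF.mono Ioo_subset_Icc_self).aestronglyMeasurable measurableSet_Ioo) C ?_
  filter_upwards [ae_restrict_mem measurableSet_Ioo] with x hx
  exact hC x (Ioo_subset_Icc_self hx)


namespace IsPrimitive

theorem integral (c : ℝ) (hf : MemLp f 2 (volIoo a b)) :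
    IsPrimitive a b (fun x => c + ∫ t in a..x, f t) f :=
  ⟨hf, fun x _ => by simp⟩

theorem of_hasDerivAt (hF : ∀ x, HasDerivAt F (f x) x) (hf : Continuous f) :
    IsPrimitive a b F f :=
  ⟨hf.continuousOn.memLp_volIoo, fun x _ => by
    rw [intervalIntegral.integral_eq_sub_of_hasDerivAt (fun y _ => hF y)
      (hf.intervalIntegrable _ _)]
    ring⟩

theorem lin (hF : IsPrimitive a b F f) (hG : IsPrimitive a b G g) (hab : a ≤ b) (s t : ℝ) :
    IsPrimitive a b (s • F + t • G) (s • f + t • g) := by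
  refine ⟨(hF.memLp.const_smul s).add (hG.memLp.const_smul t), fun x hx => ?_⟩
  have hs : uIcc a x ⊆ uIcc a b := by
    rw [uIcc_of_le hx.1, uIcc_of_le hab]; exact Icc_subset_Icc_right hx.2
  have i₁ := (hF.memLp.intervalIntegrable_of_volIoo hab).mono_set hs
  have i₂ := (hG.memLp.intervalIntegrable_of_volIoo hab).mono_set hs
  simp only [Pi.add_apply, Pi.smul_apply, smul_eq_mul]
  rw [intervalIntegral.integral_add (i₁.const_mul s) (i₂.const_mul t),
    intervalIntegral.integral_const_mul, intervalIntegral.integral_const_mul,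
    hF.eq_add_integral x hx, hG.eq_add_integral x hx]
  ring

theorem congr_right (hF : IsPrimitive a b F f) (hfg : f =ᵐ[volIoo a b] g) :
    IsPrimitive a b F g := by
  refine ⟨hF.memLp.ae_eq hfg, fun x hx => ?_⟩
  rw [hF.eq_add_integral x hx]
  congr 1
  rw [intervalIntegral.integral_of_le hx.1, intervalIntegral.integral_of_le hx.1,
    ← restrict_Ioo_eq_restrict_Ioc]
  exact integral_congr_ae (ae_restrict_of_ae_restrict_of_subset (Ioo_subset_Ioo_right hx.2) hfg)

theorem continuousOn (hF : IsPrimitive a b F f) (hab : a ≤ b) : ContinuousOn F (Icc a b) := by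
  have h : ContinuousOn (fun x => F a + ∫ t in a..x, f t) (Icc a b) := by
    refine continuousOn_const.add ?_
    rw [← uIcc_of_le hab]
    exact intervalIntegral.continuousOn_primitive_interval'
      (hF.memLp.intervalIntegrable_of_volIoo hab) left_mem_uIcc
  exact h.congr hF.eq_add_integral

theorem memLp_left (hF : IsPrimitive a b F f) (hab : a ≤ b) : MemLp F 2 (volIoo a b) :=
  (hF.continuousOn hab).memLp_volIoo

/-- Integration by parts. -/
theorem integral_mul_add (hF : IsPrimitive a b F f) (hG : IsPrimitive a b G g) (hab : a ≤ b) :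
    (∫ x in Ioo a b, f x * G x) + ∫ x in Ioo a b, F x * g x = F b * G b - F a * G a := by
  have key : ∀ {F f : ℝ → ℝ}, IsPrimitive a b F f →
      AbsolutelyContinuousOnInterval (fun x => F a + ∫ t in a..x, f t) a b ∧
      ∀ᵐ x, x ∈ Ioo a b → deriv (fun x => F a + ∫ t in a..x, f t) x = f x := by
    intro F f hF
    have hi := hF.memLp.intervalIntegrable_of_volIoo hab
    refine ⟨?_, ?_⟩
    · have h1 := hi.absolutelyContinuousOnInterval_intervalIntegral (left_mem_uIcc)
      have h2 : AbsolutelyContinuousOnInterval (fun _ : ℝ => F a) a b :=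
        (LipschitzWith.const (F a)).lipschitzOnWith.absolutelyContinuousOnInterval
      exact h2.add h1
    · filter_upwards [hi.ae_hasDerivAt_integral] with x hx hxI
      have hxI' : x ∈ uIcc a b := by rw [uIcc_of_le hab]; exact Ioo_subset_Icc_self hxI
      exact ((hx hxI' a left_mem_uIcc).const_add (F a)).deriv
  obtain ⟨acF, dF⟩ := key hF
  obtain ⟨acG, dG⟩ := key hG
  have h := acF.integral_deriv_mul_eq_sub acG
  rw [intervalIntegral.integral_of_le hab, integral_Ioc_eq_integral_Ioo,
    ← hF.eq_add_integral b ⟨hab, le_rfl⟩, ← hG.eq_add_integral b ⟨hab, le_rfl⟩,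
    intervalIntegral.integral_same, intervalIntegral.integral_same, add_zero, add_zero] at h
  have i₁ : Integrable (fun x => f x * G x) (volIoo a b) :=
    hF.memLp.integrable_mul (hG.memLp_left hab)
  have i₂ : Integrable (fun x => F x * g x) (volIoo a b) :=
    (hF.memLp_left hab).integrable_mul hG.memLp
  rw [← h, ← integral_add i₁ i₂]
  refine setIntegral_congr_ae measurableSet_Ioo ?_
  filter_upwards [dF, dG] with x h1 h2 hx
  rw [h1 hx, h2 hx, ← hF.eq_add_integral x (Ioo_subset_Icc_self hx),
    ← hG.eq_add_integral x (Ioo_subset_Icc_self hx)]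

end IsPrimitive

theorem IsTestFunction.isPrimitive {φ : ℝ → ℝ} (hφ : IsTestFunction a b φ) :
    IsPrimitive a b φ (deriv φ) :=
  .of_hasDerivAt (fun x => (hφ.contDiff.differentiable (by simp) x).hasDerivAt)
    (hφ.contDiff.continuous_deriv (by simp))

theorem IsTestFunction.eq_zero {φ : ℝ → ℝ} (hφ : IsTestFunction a b φ) {x : ℝ}
    (hx : x ∉ Ioo a b) : φ x = 0 :=
  image_eq_zero_of_notMem_tsupport fun h => hx (hφ.tsupport_subset h)

namespace IsPrimitive

theorem hasWeakDeriv (hF : IsPrimitive a b F f) (hab : a ≤ b) : HasWeakDeriv a b 1 F f := by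
  intro φ hφ
  have h := hF.integral_mul_add hφ.isPrimitive hab
  rw [hφ.eq_zero (x := a) (by simp), hφ.eq_zero (x := b) (by simp)] at h
  rw [iteratedDeriv_one]
  linarith

/-- The elementary Sobolev embedding: a primitive vanishing at `a` is bounded by the `L²` norm of
its derivative. -/
theorem enorm_le (hF : IsPrimitive a b F f) (hFa : F a = 0) {x : ℝ} (hx : x ∈ Icc a b) :
    ‖F x‖ₑ ≤ eLpNorm f 2 (volIoo a b) * volIoo a b univ ^ (1 / 2 : ℝ) := by
  rw [hF.eq_add_integral x hx, hFa, zero_add, intervalIntegral.integral_of_le hx.1,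
    integral_Ioc_eq_integral_Ioo]
  calc ‖∫ t in Ioo a x, f t‖ₑ ≤ ∫⁻ t in Ioo a x, ‖f t‖ₑ := enorm_integral_le_lintegral_enorm _
    _ ≤ ∫⁻ t in Ioo a b, ‖f t‖ₑ := lintegral_mono_set (Ioo_subset_Ioo_right hx.2)
    _ = eLpNorm f 1 (volIoo a b) := eLpNorm_one_eq_lintegral_enorm.symm
    _ ≤ _ := by
      refine (eLpNorm_le_eLpNorm_mul_rpow_measure_univ (q := 2) (by norm_num)
        hF.memLp.1).trans_eq ?_
      norm_num

theorem eLpNorm_le (hF : IsPrimitive a b F f) (hFa : F a = 0) :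
    eLpNorm F 2 (volIoo a b) ≤ eLpNorm f 2 (volIoo a b) * volIoo a b univ := by
  have h : ∀ᵐ x ∂volIoo a b,
      ‖F x‖ₑ ≤ eLpNorm f 2 (volIoo a b) * volIoo a b univ ^ (1 / 2 : ℝ) := by
    filter_upwards [ae_restrict_mem measurableSet_Ioo] with x hx
    exact hF.enorm_le hFa (Ioo_subset_Icc_self hx)
  refine (eLpNorm_le_of_ae_enorm_bound h).trans_eq ?_
  rw [smul_eq_mul, mul_assoc, ← ENNReal.rpow_add_of_nonneg _ _ (by norm_num) (by norm_num)]
  norm_num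

end IsPrimitive

/-! ### Weak derivatives and primitives -/

theorem exists_isTestFunction_integral_eq_one (hab : a < b) :
    ∃ ψ, IsTestFunction a b ψ ∧ ∫ x in Ioo a b, ψ x = 1 := by
  let B : ContDiffBump ((a + b) / 2) := ⟨(b - a) / 8, (b - a) / 4, by linarith, by linarith⟩
  have hs : tsupport (B.normed volume) ⊆ Ioo a b := by
    rw [B.tsupport_normed_eq, Real.closedBall_eq_Icc]
    intro x hx
    have h1 : (a + b) / 2 - (b - a) / 4 ≤ x := hx.1
    have h2 : x ≤ (a + b) / 2 + (b - a) / 4 := hx.2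
    constructor <;> linarith
  refine ⟨B.normed volume, ⟨B.contDiff_normed, B.hasCompactSupport_normed, hs⟩, ?_⟩
  rw [setIntegral_eq_integral_of_forall_compl_eq_zero, B.integral_normed]
  exact fun x hx => image_eq_zero_of_notMem_tsupport fun h => hx (hs h)

/-- A test function of zero mean is the derivative of a test function. -/
theorem IsTestFunction.exists_deriv_eq {χ : ℝ → ℝ} (hχ : IsTestFunction a b χ) (hab : a < b)
    (h0 : ∫ x in Ioo a b, χ x = 0) : ∃ φ, IsTestFunction a b φ ∧ deriv φ = χ := by
  have hd : ∀ x, HasDerivAt (fun x => ∫ t in a..x, χ t) (χ x) x := fun x =>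
    intervalIntegral.integral_hasDerivAt_right (hχ.contDiff.continuous.intervalIntegrable _ _)
      (hχ.contDiff.continuous.stronglyMeasurableAtFilter _ _) hχ.contDiff.continuous.continuousAt
  have hderiv : deriv (fun x => ∫ t in a..x, χ t) = χ := funext fun x => (hd x).deriv
  obtain ⟨c, d, hca, hdb, hcd⟩ : ∃ c d, a < c ∧ d < b ∧ tsupport χ ⊆ Icc c d := by
    rcases (tsupport χ).eq_empty_or_nonempty with he | hne
    · exact ⟨b, a, hab, hab, by simp [he]⟩
    · obtain ⟨c, hc⟩ := hχ.hasCompactSupport.isCompact.exists_isLeast hne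
      obtain ⟨d, hd⟩ := hχ.hasCompactSupport.isCompact.exists_isGreatest hne
      exact ⟨c, d, (hχ.tsupport_subset hc.1).1, (hχ.tsupport_subset hd.1).2,
        fun x hx => ⟨hc.2 hx, hd.2 hx⟩⟩
  have hz : ∀ x ∉ Icc c d, χ x = 0 := fun x hx =>
    image_eq_zero_of_notMem_tsupport fun h => hx (hcd h)
  have hsupp : Function.support (fun x => ∫ t in a..x, χ t) ⊆ Icc c d := by
    refine Function.support_subset_iff'.2 fun x hx => ?_
    by_cases hxc : x < c
    · refine (intervalIntegral.integral_congr (g := fun _ => 0) fun t ht => hz t fun h => ?_).trans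
        (by simp)
      exact absurd h.1 (not_le.2 (ht.2.trans_lt (max_lt hca hxc)))
    · have hxd : d < x := not_le.1 fun h => hx ⟨not_lt.1 hxc, h⟩
      have h1 : ∫ t in a..b, χ t = 0 := by
        rw [intervalIntegral.integral_of_le hab.le, integral_Ioc_eq_integral_Ioo, h0]
      have h2 : ∫ t in b..x, χ t = 0 := by
        refine (intervalIntegral.integral_congr (g := fun _ => 0)
          fun t ht => hz t fun h => ?_).trans (by simp)
        exact absurd h.2 (not_le.2 ((lt_min hdb hxd).trans_le ht.1))
      change ∫ t in a..x, χ t = 0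
      rw [← intervalIntegral.integral_add_adjacent_intervals
        (hχ.contDiff.continuous.intervalIntegrable a b)
        (hχ.contDiff.continuous.intervalIntegrable b x), h1, h2, add_zero]
  have hts : tsupport (fun x => ∫ t in a..x, χ t) ⊆ Icc c d :=
    closure_minimal hsupp isClosed_Icc
  refine ⟨_, ⟨?_, HasCompactSupport.of_support_subset_isCompact isCompact_Icc hsupp, ?_⟩, hderiv⟩
  · rw [contDiff_infty_iff_deriv, hderiv]
    exact ⟨fun x => (hd x).differentiableAt, hχ.contDiff⟩
  · exact hts.trans fun x hx => ⟨hca.trans_le hx.1, hx.2.trans_lt hdb⟩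

/-- The du Bois-Reymond lemma: subtracting from a test function `φ` the multiple `(∫ φ) ψ` of a fixed
one of mass `1` leaves the derivative of a test function, so `f` tests `φ` like the constant
`∫ f ψ`. -/
theorem HasWeakDeriv.exists_ae_eq_const (h : HasWeakDeriv a b 1 f 0) (hf : MemLp f 2 (volIoo a b))
    (hab : a < b) : ∃ c : ℝ, f =ᵐ[volIoo a b] fun _ => c := by
  obtain ⟨ψ, hψ, hψ1⟩ := exists_isTestFunction_integral_eq_one hab
  refine ⟨∫ x in Ioo a b, f x * ψ x, ?_⟩
  set c := ∫ x in Ioo a b, f x * ψ x with hc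
  have h0 : HasWeakDeriv a b 0 f f := fun φ _ => by simp
  refine h0.ae_unique (fun φ hφ => ?_) hf (memLp_const c)
  set m := ∫ x in Ioo a b, φ x with hm
  have iφ : Integrable φ (volIoo a b) := hφ.memLp.integrable (by norm_num)
  have iψ : Integrable ψ (volIoo a b) := hψ.memLp.integrable (by norm_num)
  obtain ⟨Φ, hΦ, hΦd⟩ := (hφ.lin hψ 1 (-m)).exists_deriv_eq hab (by
    have e : ∀ x, ((1 : ℝ) • φ + (-m) • ψ) x = φ x - m * ψ x := fun x => by
      simp [sub_eq_add_neg]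
    simp only [e]
    rw [integral_sub iφ (iψ.const_mul m), integral_const_mul, hψ1, mul_one, ← hm, sub_self])
  have h1 := h Φ hΦ
  have i₁ : Integrable (fun x => f x * φ x) (volIoo a b) := hf.integrable_mul hφ.memLp
  have i₂ : Integrable (fun x => f x * ψ x) (volIoo a b) := hf.integrable_mul hψ.memLp
  have e : ∀ x, f x * ((1 : ℝ) • φ + (-m) • ψ) x = f x * φ x - m * (f x * ψ x) := fun x => by
    simp only [Pi.add_apply, Pi.smul_apply, smul_eq_mul]; ring
  rw [iteratedDeriv_one, hΦd] at h1
  simp only [e, Pi.zero_apply, zero_mul, integral_zero, mul_zero] at h1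
  rw [integral_sub i₁ (i₂.const_mul m), integral_const_mul, ← hc] at h1
  simp only [iteratedDeriv_zero, pow_zero, one_mul, integral_const_mul, ← hm]
  linarith

theorem HasWeakDeriv.exists_isPrimitive (h : HasWeakDeriv a b 1 f g)
    (hf : MemLp f 2 (volIoo a b)) (hg : MemLp g 2 (volIoo a b)) (hab : a < b) :
    ∃ F, IsPrimitive a b F g ∧ f =ᵐ[volIoo a b] F := by
  have hP := IsPrimitive.integral 0 hg
  have hPm := hP.memLp_left hab.le
  obtain ⟨c, hc⟩ := HasWeakDeriv.exists_ae_eq_const (by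
    simpa using h.lin (hP.hasWeakDeriv hab.le) hf hPm hg hg 1 (-1) (ae_eq_refl _))
    ((hf.const_smul (1 : ℝ)).add (hPm.const_smul (-1 : ℝ))) hab
  refine ⟨_, IsPrimitive.integral c hg, ?_⟩
  filter_upwards [hc] with x hx
  simp only [Pi.add_apply, Pi.smul_apply, smul_eq_mul] at hx
  linarith

theorem HasWeakDeriv.congr_left {k : ℕ} (h : HasWeakDeriv a b k f g) (e : F =ᵐ[volIoo a b] f) :
    HasWeakDeriv a b k F g := fun φ hφ => by
  rw [← h φ hφ]
  refine integral_congr_ae ?_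
  filter_upwards [e] with x hx
  rw [hx]

theorem IsTestFunction.deriv {φ : ℝ → ℝ} (hφ : IsTestFunction a b φ) :
    IsTestFunction a b (deriv φ) :=
  ⟨(contDiff_infty_iff_deriv.1 hφ.contDiff).2, hφ.hasCompactSupport.deriv,
    (tsupport_deriv_subset (f := φ)).trans hφ.tsupport_subset⟩

theorem IsTestFunction.iteratedDeriv {φ : ℝ → ℝ} (hφ : IsTestFunction a b φ) (k : ℕ) :
    IsTestFunction a b (iteratedDeriv k φ) := by
  induction k with
  | zero => simpa using hφ
  | succ k ih => rw [iteratedDeriv_succ]; exact ih.deriv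

theorem HasWeakDeriv.succ {k : ℕ} (h : HasWeakDeriv a b 1 F f) (h' : HasWeakDeriv a b k f g) :
    HasWeakDeriv a b (k + 1) F g := fun φ hφ => by
  have h1 := h _ (hφ.iteratedDeriv k)
  rw [iteratedDeriv_one, ← iteratedDeriv_succ, h' φ hφ] at h1
  rw [h1]; ring

theorem HasWeakDeriv.of_succ {k : ℕ} (h : HasWeakDeriv a b k F f)
    (h' : HasWeakDeriv a b (k + 1) F g) : HasWeakDeriv a b 1 f g := fun φ hφ => by
  have h1 := h _ hφ.deriv
  rw [← iteratedDeriv_succ', h' φ hφ, pow_succ, mul_assoc] at h1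
  rw [iteratedDeriv_one, pow_one]
  exact (mul_left_cancel₀ (pow_ne_zero k (by norm_num)) h1).symm

/-! ### Traces and `H¹₀` -/

theorem HasTrace.eq_of_ae_eq {x c : ℝ} (h : HasTrace a b f x c) (hab : a < b)
    (hF : ContinuousOn F (Icc a b)) (e : f =ᵐ[volIoo a b] F) (hx : x ∈ Icc a b) : F x = c := by
  obtain ⟨G, hG, eG, rfl⟩ := h
  refine Measure.eqOn_Icc_of_ae_eq volume hab.ne ?_ hF hG hx
  rw [← restrict_Ioo_eq_restrict_Icc]
  exact e.symm.trans eG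

/-- The derivatives of test functions are dense in the functions of zero mean: their orthogonal
complement consists of the constants, by the du Bois-Reymond lemma. -/
theorem exists_tendsto_eLpNorm_deriv_sub (hg : MemLp g 2 (volIoo a b)) (hab : a < b)
    (h0 : ∫ x in Ioo a b, g x = 0) : ∃ φ : ℕ → ℝ → ℝ, (∀ n, IsTestFunction a b (φ n)) ∧
      Tendsto (fun n => eLpNorm (deriv (φ n) - g) 2 (volIoo a b)) atTop (𝓝 0) := by
  let K : Submodule ℝ (Lp ℝ 2 (volIoo a b)) :=
    { carrier := {f | ∃ φ, IsTestFunction a b φ ∧ f =ᵐ[volIoo a b] deriv φ}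
      zero_mem' := ⟨0, ⟨contDiff_const, HasCompactSupport.zero, by simp [tsupport]⟩, by
        filter_upwards [Lp.coeFn_zero ℝ 2 (volIoo a b)] with x hx
        rw [hx]
        simp⟩
      add_mem' := by
        rintro f g ⟨φ, hφ, hf⟩ ⟨ψ, hψ, hg⟩
        refine ⟨(1 : ℝ) • φ + (1 : ℝ) • ψ, hφ.lin hψ 1 1, ?_⟩
        filter_upwards [Lp.coeFn_add f g, hf, hg] with x h1 h2 h3
        rw [one_smul, one_smul, deriv_add (hφ.contDiff.differentiable (by simp) x)
          (hψ.contDiff.differentiable (by simp) x), h1, Pi.add_apply, h2, h3]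
      smul_mem' := by
        rintro s f ⟨φ, hφ, hf⟩
        refine ⟨s • φ + (0 : ℝ) • φ, hφ.lin hφ s 0, ?_⟩
        filter_upwards [Lp.coeFn_smul s f, hf] with x h1 h2
        rw [zero_smul, add_zero, deriv_const_smul s (hφ.contDiff.differentiable (by simp) x), h1,
          Pi.smul_apply, h2] }
  have hmem : hg.toLp g ∈ Kᗮᗮ := by
    refine (Submodule.mem_orthogonal _ _).2 fun w hw => ?_
    have hw' : HasWeakDeriv a b 1 w 0 := fun φ hφ => by
      have hφ' := hφ.deriv.memLp
      have h1 := (Submodule.mem_orthogonal _ _).1 hw (hφ'.toLp _) ⟨φ, hφ, hφ'.coeFn_toLp⟩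
      rw [L2.inner_def] at h1
      simp only [Pi.zero_apply, zero_mul, integral_zero, mul_zero, iteratedDeriv_one]
      rw [← h1]
      refine integral_congr_ae ?_
      filter_upwards [hφ'.coeFn_toLp] with x hx
      simp [hx]
    obtain ⟨c, hc⟩ := hw'.exists_ae_eq_const (Lp.memLp w) hab
    rw [L2.inner_def]
    have : ∫ x in Ioo a b, c * g x = 0 := by rw [integral_const_mul, h0, mul_zero]
    rw [← this]
    refine integral_congr_ae ?_
    filter_upwards [hc, hg.coeFn_toLp] with x h1 h2
    simp [h1, h2, mul_comm]
  rw [K.orthogonal_orthogonal_eq_closure] at hmem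
  obtain ⟨u, hu, hlim⟩ := mem_closure_iff_seq_limit.1 hmem
  choose φ hφ huφ using hu
  refine ⟨φ, hφ, ?_⟩
  refine ((Lp.tendsto_Lp_iff_tendsto_eLpNorm' _ _).1 hlim).congr fun n => eLpNorm_congr_ae ?_
  filter_upwards [huφ n, hg.coeFn_toLp] with x h1 h2
  simp [h1, h2]

theorem IsPrimitive.memSobolev_one (hF : IsPrimitive a b F f) (hab : a ≤ b) :
    MemSobolev 1 a b F := by
  refine ⟨hF.memLp_left hab, fun k hk => ?_⟩
  interval_cases k
  · exact ⟨F, hF.memLp_left hab, fun φ _ => by simp⟩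
  · exact ⟨f, hF.memLp, hF.hasWeakDeriv hab⟩

theorem IsPrimitive.weakDeriv_one_ae_eq (hF : IsPrimitive a b F f) (hab : a ≤ b) :
    weakDeriv a b 1 F =ᵐ[volIoo a b] f :=
  let h := (hF.memSobolev_one hab).weakDeriv_spec le_rfl
  h.2.ae_unique (hF.hasWeakDeriv hab) h.1 hF.memLp

/-- Convergence of the derivatives in `L²` carries over to functions vanishing at `a`, both
uniformly and in `L²`. -/
theorem IsPrimitive.tendsto_of_tendsto_deriv (hF : IsPrimitive a b F f) (hab : a ≤ b)
    (ha : F a = 0) {φ : ℕ → ℝ → ℝ} (hφ : ∀ n, IsTestFunction a b (φ n))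
    (hlim : Tendsto (fun n => eLpNorm (deriv (φ n) - f) 2 (volIoo a b)) atTop (𝓝 0)) :
    (∀ x ∈ Icc a b, Tendsto (fun n => φ n x) atTop (𝓝 (F x))) ∧
      Tendsto (fun n => eLpNorm (φ n - F) 2 (volIoo a b)) atTop (𝓝 0) := by
  have hd : ∀ n, IsPrimitive a b (φ n - F) (deriv (φ n) - f) := fun n => by
    have e : ∀ p q : ℝ → ℝ, (1 : ℝ) • p + (-1 : ℝ) • q = p - q := fun p q => by
      rw [one_smul, neg_one_smul, sub_eq_add_neg]
    have h := (hφ n).isPrimitive.lin hF hab 1 (-1)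
    rwa [e, e] at h
  have hda : ∀ n, (φ n - F) a = 0 := fun n => by
    simp [ha, (hφ n).eq_zero (x := a) (by simp)]
  have hmul : ∀ C : ℝ≥0∞, C ≠ ⊤ →
      Tendsto (fun n => eLpNorm (deriv (φ n) - f) 2 (volIoo a b) * C) atTop (𝓝 0) := fun C hC => by
    simpa using ENNReal.Tendsto.mul_const hlim (Or.inr hC)
  refine ⟨fun x hx => ?_, ?_⟩
  · rw [tendsto_iff_edist_tendsto_0]
    refine tendsto_of_tendsto_of_tendsto_of_le_of_le tendsto_const_nhds
      (hmul _ (ENNReal.rpow_ne_top_of_nonneg (y := 1 / 2) (by norm_num) (measure_ne_top (volIoo a b) univ)))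
      (fun _ => zero_le) fun n => ?_
    rw [edist_eq_enorm_sub]
    exact (hd n).enorm_le (hda n) hx
  · exact tendsto_of_tendsto_of_tendsto_of_le_of_le tendsto_const_nhds
      (hmul _ (measure_ne_top (volIoo a b) univ)) (fun _ => zero_le)
      fun n => (hd n).eLpNorm_le (hda n)

theorem IsPrimitive.memH10 (hF : IsPrimitive a b F f) (hab : a < b) (ha : F a = 0)
    (hb : F b = 0) : MemH10 a b F := by
  obtain ⟨φ, hφ, hlim⟩ := exists_tendsto_eLpNorm_deriv_sub hF.memLp hab (by
    have h := hF.eq_add_integral b ⟨hab.le, le_rfl⟩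
    rw [ha, hb, zero_add, intervalIntegral.integral_of_le hab.le,
      integral_Ioc_eq_integral_Ioo] at h
    exact h.symm)
  refine ⟨hF.memSobolev_one hab.le, φ, hφ, (hF.tendsto_of_tendsto_deriv hab.le ha hφ hlim).2, ?_⟩
  refine hlim.congr fun n => eLpNorm_congr_ae ?_
  filter_upwards [hF.weakDeriv_one_ae_eq hab.le] with x hx
  simp [hx]

theorem MemH10.eq_zero_of_isPrimitive (hf : MemH10 a b f) (hF : IsPrimitive a b F g)
    (e : f =ᵐ[volIoo a b] F) (hab : a < b) : F a = 0 ∧ F b = 0 := by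
  obtain ⟨φ, hφ, hlim0, hlim1⟩ := hf.exists_approx
  have hg : weakDeriv a b 1 f =ᵐ[volIoo a b] g := by
    have h := hf.memSobolev.weakDeriv_spec (k := 1) le_rfl
    exact h.2.ae_unique ((hF.hasWeakDeriv hab.le).congr_left e) h.1 hF.memLp
  have hlim : Tendsto (fun n => eLpNorm (deriv (φ n) - g) 2 (volIoo a b)) atTop (𝓝 0) := by
    refine hlim1.congr fun n => eLpNorm_congr_ae ?_
    filter_upwards [hg] with x hx
    simp [hx]
  -- The test functions converge to the primitive of `g` vanishing at `a`, which is `F - F a`.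
  have hG := IsPrimitive.integral 0 hF.memLp
  obtain ⟨hpt, hL2⟩ := hG.tendsto_of_tendsto_deriv hab.le (by simp) hφ hlim
  have hb : F b = F a := by
    have h := hpt b ⟨hab.le, le_rfl⟩
    simp only [(hφ _).eq_zero (x := b) (by simp), zero_add] at h
    rw [hF.eq_add_integral b ⟨hab.le, le_rfl⟩, ← tendsto_nhds_unique tendsto_const_nhds h, add_zero]
  have hconst : Tendsto (fun _ : ℕ => eLpNorm ((fun _ => 0) - fun _ => F a) 2 (volIoo a b)) atTop
      (𝓝 0) := by
    refine tendsto_eLpNorm_lin (s := 1) (t := -1) ?_ (fun n => ?_)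
      (fun n => ((hφ n).memLp.sub hf.memSobolev.memLp).1)
      (fun n => ((hφ n).memLp.sub (hG.memLp_left hab.le)).1) hlim0 hL2
    · filter_upwards [e, ae_restrict_mem measurableSet_Ioo] with x hx hxI
      rw [Pi.add_apply, Pi.smul_apply, Pi.smul_apply, hx,
        hF.eq_add_integral x (Ioo_subset_Icc_self hxI)]
      simp
    · funext x; simp
  have hzero := tendsto_nhds_unique tendsto_const_nhds hconst
  have hFa : F a = 0 := by
    rw [eLpNorm_eq_zero_iff ((memLp_const 0).sub (memLp_const (F a)) (p := 2)).1 (by norm_num)] at hzero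
    have hne : (ae (volIoo a b)).NeBot := by
      rw [ae_neBot, Ne, Measure.restrict_eq_zero, Real.volume_Ioo, ENNReal.ofReal_eq_zero]
      linarith
    obtain ⟨x, hx⟩ := hzero.exists
    simpa using hx
  exact ⟨hFa, hb.trans hFa⟩

end Primitives

/-! ### Third-order primitives -/

section ThirdPrimitives

variable {a b : ℝ} {F F₁ F₂ f g : ℝ → ℝ}

/-- `F` has the successive derivatives `F₁`, `F₂` and `f ∈ L²(a, b)` on `[a, b]`, the last one in
the sense of absolutely continuous functions. -/
structure IsThirdPrimitive (a b : ℝ) (F F₁ F₂ f : ℝ → ℝ) : Prop where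
  zero : IsPrimitive a b F F₁
  one : IsPrimitive a b F₁ F₂
  two : IsPrimitive a b F₂ f

/-- The weak derivatives of a function in `H³` up to order two have absolutely continuous
representatives, each a primitive of the next. -/
theorem MemSobolev.exists_isThirdPrimitive (hf : MemSobolev 3 a b f) (hab : a < b) :
    ∃ F F₁ F₂, IsThirdPrimitive a b F F₁ F₂ (weakDeriv a b 3 f) ∧ f =ᵐ[volIoo a b] F ∧
      weakDeriv a b 1 f =ᵐ[volIoo a b] F₁ := by
  have h₁ := hf.weakDeriv_spec (k := 1) (by norm_num)
  have h₂ := hf.weakDeriv_spec (k := 2) (by norm_num)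
  have h₃ := hf.weakDeriv_spec (k := 3) (by norm_num)
  obtain ⟨F, hF, eF⟩ := h₁.2.exists_isPrimitive hf.memLp h₁.1 hab
  obtain ⟨F₁, hF₁, eF₁⟩ := (h₁.2.of_succ h₂.2).exists_isPrimitive h₁.1 h₂.1 hab
  obtain ⟨F₂, hF₂, eF₂⟩ := (h₂.2.of_succ h₃.2).exists_isPrimitive h₂.1 h₃.1 hab
  exact ⟨F, F₁, F₂, ⟨hF.congr_right eF₁, hF₁.congr_right eF₂, hF₂⟩, eF, eF₁⟩

theorem IsPrimitive.integral_mul_self (hF : IsPrimitive a b F f) (hab : a ≤ b) :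
    ∫ x in Ioo a b, f x * F x = (F b ^ 2 - F a ^ 2) / 2 := by
  have h := hF.integral_mul_add hF hab
  have e : ∫ x in Ioo a b, F x * f x = ∫ x in Ioo a b, f x * F x := by simp only [mul_comm]
  rw [e] at h
  linarith

/-- Two integrations by parts: `∫ F''' F = -[F'² / 2]` when `F` vanishes at both ends. -/
theorem IsThirdPrimitive.integral_mul_self (h : IsThirdPrimitive a b F F₁ F₂ f) (hab : a ≤ b)
    (ha : F a = 0) (hb : F b = 0) :
    ∫ x in Ioo a b, f x * F x = -(F₁ b ^ 2 - F₁ a ^ 2) / 2 := by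
  have h1 := h.two.integral_mul_add h.zero hab
  have h2 := h.one.integral_mul_self hab
  rw [h2, ha, hb] at h1
  linarith

theorem IsThirdPrimitive.memSobolev (h : IsThirdPrimitive a b F F₁ F₂ f) (hab : a ≤ b) :
    MemSobolev 3 a b F := by
  refine ⟨h.zero.memLp_left hab, fun k hk => ?_⟩
  have h₁ := h.zero.hasWeakDeriv hab
  have h₂ := h.one.hasWeakDeriv hab
  interval_cases k
  · exact ⟨F, h.zero.memLp_left hab, fun φ _ => by simp⟩
  · exact ⟨F₁, h.zero.memLp, h₁⟩
  · exact ⟨F₂, h.one.memLp, h₁.succ h₂⟩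
  · exact ⟨f, h.two.memLp, h₁.succ (h₂.succ (h.two.hasWeakDeriv hab))⟩

theorem IsThirdPrimitive.weakDeriv_three_ae_eq (h : IsThirdPrimitive a b F F₁ F₂ f) (hab : a ≤ b)
    (e : g =ᵐ[volIoo a b] F) (hg : MemSobolev 3 a b g) :
    weakDeriv a b 3 g =ᵐ[volIoo a b] f :=
  let s := hg.weakDeriv_spec le_rfl
  s.2.ae_unique (HasWeakDeriv.congr_left ((h.zero.hasWeakDeriv hab).succ
    ((h.one.hasWeakDeriv hab).succ (h.two.hasWeakDeriv hab))) e) s.1 h.two.memLp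

theorem IsThirdPrimitive.hasTrace_weakDeriv_one (h : IsThirdPrimitive a b F F₁ F₂ f) (hab : a ≤ b)
    (x : ℝ) : HasTrace a b (weakDeriv a b 1 F) x (F₁ x) :=
  ⟨F₁, h.one.continuousOn hab, h.zero.weakDeriv_one_ae_eq hab, rfl⟩

/-- A square integrable function has a third primitive with `F(0) = 0`; the two remaining constants
of integration multiply `x² / 2` and `x`. Only the boundary values of the family are recorded, in
terms of those of the member `w` with `w(0) = w'(0) = w''(0) = 0` and of its derivative `w₁`. -/
theorem exists_isThirdPrimitive {L : ℝ} (hL : 0 ≤ L) (hf : MemLp f 2 (volIoo 0 L)) :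
    ∃ w w₁ : ℝ → ℝ, ∀ c d : ℝ, ∃ F F₁ F₂, IsThirdPrimitive 0 L F F₁ F₂ f ∧ F 0 = 0 ∧
      F L = w L + c * (L ^ 2 / 2) + d * L ∧ F₁ 0 = d ∧ F₁ L = w₁ L + c * L + d := by
  have key : ∀ {g : ℝ → ℝ}, MemLp g 2 (volIoo 0 L) → ∃ w, IsPrimitive 0 L w g ∧ w 0 = 0 :=
    fun hg => ⟨_, .integral 0 hg, by simp⟩
  obtain ⟨w₂, h₂, -⟩ := key hf
  obtain ⟨w₁, h₁, hw₁⟩ := key (h₂.memLp_left hL)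
  obtain ⟨w, h₀, hw⟩ := key (h₁.memLp_left hL)
  refine ⟨w, w₁, fun c d => ?_⟩
  have q₂ : IsPrimitive 0 L (fun _ => c) (fun _ => 0) :=
    .of_hasDerivAt (fun x => hasDerivAt_const x c) continuous_const
  have q₁ : IsPrimitive 0 L (fun x => c * x + d) (fun _ => c) :=
    .of_hasDerivAt (fun x => by
      simpa using ((hasDerivAt_id x).const_mul c).add_const d) continuous_const
  have q₀ : IsPrimitive 0 L (fun x => c * (x ^ 2 / 2) + d * x) (fun x => c * x + d) :=
    .of_hasDerivAt (fun x => by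
      convert! (((hasDerivAt_pow 2 x).div_const 2).const_mul c).add
        ((hasDerivAt_id x).const_mul d) using 1
      simp) (by fun_prop)
  refine ⟨_, _, _, ⟨h₀.lin q₀ hL 1 1, h₁.lin q₁ hL 1 1, ?_⟩, ?_, ?_, ?_, ?_⟩
  · convert! h₂.lin q₂ hL 1 1 using 1
    funext x; simp
  · simp [hw]
  · simp [add_assoc]
  · simp [hw₁]
  · simp [add_assoc]

theorem exists_isThirdPrimitive_left {L : ℝ} (hL : 0 < L) (hf : MemLp f 2 (volIoo 0 L)) :
    ∃ F F₁ F₂, IsThirdPrimitive 0 L F F₁ F₂ f ∧ F 0 = 0 ∧ F L = 0 ∧ F₁ 0 = 0 := by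
  obtain ⟨w, w₁, h⟩ := exists_isThirdPrimitive hL.le hf
  obtain ⟨F, F₁, F₂, hF, h0, hFL, h1, -⟩ := h (-2 * w L / L ^ 2) 0
  refine ⟨F, F₁, F₂, hF, h0, ?_, h1⟩
  rw [hFL]; field_simp; ring

theorem exists_isThirdPrimitive_right {L : ℝ} (hL : 0 < L) (hf : MemLp f 2 (volIoo 0 L)) (r : ℝ) :
    ∃ F F₁ F₂, IsThirdPrimitive 0 L F F₁ F₂ f ∧ F 0 = 0 ∧ F L = 0 ∧ F₁ L = r := by
  obtain ⟨w, w₁, h⟩ := exists_isThirdPrimitive hL.le hf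
  -- `c` and `d` solve `c L² / 2 + d L = -w(L)` and `c L + d = r - w₁(L)`.
  obtain ⟨F, F₁, F₂, hF, h0, hFL, -, h1⟩ := h (2 * (L * (r - w₁ L) + w L) / L ^ 2)
    (r - w₁ L - 2 * (L * (r - w₁ L) + w L) / L)
  refine ⟨F, F₁, F₂, hF, h0, ?_, ?_⟩
  · rw [hFL]; field_simp; ring
  · rw [h1]; field_simp; ring

end ThirdPrimitives

/-! ### Dissipativity and surjectivity of the Hirota-Satsuma operator -/

namespace HirotaSatsuma

variable {L α β h : ℝ}

theorem A_inner_self_nonpos (hL : 0 < L) (hβ : 0 < β) (hh : 0 < h)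
    (hcond : 2 * α ^ 2 + 3 / 2 * β < 1 / 2) (U : (A L α β h hβ hh).domain) :
    inner ℝ (A L α β h hβ hh U) (U : H L β h) ≤ 0 := by
  obtain ⟨U, hU⟩ := U
  have hD : InDomain L α β U.fst.fst U.fst.snd U.snd := hU
  obtain ⟨p, q, tr0, trp, trz0, trz1, trv⟩ := hD.boundary
  obtain ⟨u, u₁, u₂, hu, eu, eu₁⟩ := hD.u_H3.exists_isThirdPrimitive hL
  obtain ⟨v, v₁, v₂, hv, ev, ev₁⟩ := hD.v_H3.exists_isThirdPrimitive hL
  obtain ⟨hz'm, hz'd⟩ := hD.z_H1.weakDeriv_spec (k := 1) le_rfl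
  obtain ⟨z, hz, ez⟩ := hz'd.exists_isPrimitive hD.z_H1.memLp hz'm one_pos
  obtain ⟨hu0, huL⟩ := hD.u_H10.eq_zero_of_isPrimitive hu.zero eu hL
  obtain ⟨hv0, hvL⟩ := hD.v_H10.eq_zero_of_isPrimitive hv.zero ev hL
  have hLI : L ∈ Icc 0 L := ⟨hL.le, le_rfl⟩
  have h0I : (0 : ℝ) ∈ Icc 0 L := ⟨le_rfl, hL.le⟩
  have bu0 := tr0.eq_of_ae_eq hL (hu.one.continuousOn hL.le) eu₁ h0I
  have buL := trp.eq_of_ae_eq hL (hu.one.continuousOn hL.le) eu₁ hLI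
  have bvL := trv.eq_of_ae_eq hL (hv.one.continuousOn hL.le) ev₁ hLI
  have bz0 := trz0.eq_of_ae_eq one_pos (hz.continuousOn zero_le_one) ez (by simp)
  have bz1 := trz1.eq_of_ae_eq one_pos (hz.continuousOn zero_le_one) ez (by simp)
  change inner ℝ (applyA h hD) U ≤ 0
  rw [inner_eq hβ hh]
  have I₁ : ∫ x in Ioo 0 L, (applyA h hD).fst.fst x * U.fst.fst x
      = 1 / 2 * (-(u₁ L ^ 2 - u₁ 0 ^ 2) / 2) := by
    rw [← hu.integral_mul_self hL.le hu0 huL, ← integral_const_mul]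
    refine integral_congr_ae ?_
    filter_upwards [eu, MemLp.coeFn_toLp
      ((hD.u_H3.weakDeriv_spec le_rfl).1.const_smul (1 / 2 : ℝ))] with x h1 h2
    rw [h1, show (applyA h hD).fst.fst x = _ from h2, Pi.smul_apply, smul_eq_mul, mul_assoc]
  have I₂ : ∫ x in Ioo 0 L, (applyA h hD).fst.snd x * U.fst.snd x
      = (v₁ L ^ 2 - v₁ 0 ^ 2) / 2 := by
    rw [show (v₁ L ^ 2 - v₁ 0 ^ 2) / 2 = -(-(v₁ L ^ 2 - v₁ 0 ^ 2) / 2) by ring,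
      ← hv.integral_mul_self hL.le hv0 hvL, ← integral_neg]
    refine integral_congr_ae ?_
    filter_upwards [ev, MemLp.coeFn_toLp (hD.v_H3.weakDeriv_spec le_rfl).1.neg] with x h1 h2
    rw [h1, show (applyA h hD).fst.snd x = _ from h2, Pi.neg_apply, neg_mul]
  have I₃ : ∫ x in Ioo 0 1, (applyA h hD).snd x * U.snd x
      = -(1 / h) * ((z 1 ^ 2 - z 0 ^ 2) / 2) := by
    rw [← hz.integral_mul_self zero_le_one, ← integral_const_mul]
    refine integral_congr_ae ?_
    have h3 := MemLp.coeFn_toLp (memLp_weighted (c := β * h)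
      ((hD.z_H1.weakDeriv_spec le_rfl).1.const_smul (-(1 / h))))
    rw [Filter.EventuallyEq, ae_weighted (mul_pos hβ hh)] at h3
    filter_upwards [ez, h3] with x h1 h2
    rw [h1, show (applyA h hD).snd x = _ from h2, Pi.smul_apply, smul_eq_mul, mul_assoc]
  rw [I₁, I₂, I₃, bu0, buL, bvL, bz0, bz1,
    show β * h * (-(1 / h) * ((q ^ 2 - p ^ 2) / 2)) = -β * ((q ^ 2 - p ^ 2) / 2) by
      field_simp]
  -- `(α p + β q)² ≤ 2 α² p² + 2 β² q²`, and the smallness condition absorbs both terms.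
  have hβ' : β < 1 / 3 := by nlinarith [sq_nonneg α]
  nlinarith [sq_nonneg (α * p - β * q), sq_nonneg (v₁ 0), mul_nonneg (sq_nonneg p)
    (by linarith : 0 ≤ 1 / 4 - α ^ 2 - β / 2),
    mul_nonneg (mul_nonneg hβ.le (sq_nonneg q)) (by linarith : 0 ≤ 1 / 2 - β)]

theorem A_surjective (hL : 0 < L) (hβ : 0 < β) (hh : 0 < h) (W : H L β h) :
    ∃ U : (A L α β h hβ hh).domain, A L α β h hβ hh U = W := by
  have hζ : MemLp W.snd 2 (volIoo 0 1) := by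
    have hc : ENNReal.ofReal (β * h) ≠ 0 := by simpa using mul_pos hβ hh
    have h1 := (Lp.memLp W.snd).smul_measure (ENNReal.inv_ne_top.2 hc)
    rwa [smul_smul, ENNReal.inv_mul_cancel hc ENNReal.ofReal_ne_top, one_smul] at h1
  obtain ⟨u, u₁, u₂, hu, u0, uL, hu0⟩ :=
    exists_isThirdPrimitive_left hL ((Lp.memLp W.fst.fst).const_smul (2 : ℝ))
  have hz := IsPrimitive.integral (u₁ L) (hζ.const_smul (-h))
  set z : ℝ → ℝ := fun x => u₁ L + ∫ t in (0 : ℝ)..x, ((-h) • ⇑W.snd) t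
  obtain ⟨v, v₁, v₂, hv, v0, vL, hvL⟩ :=
    exists_isThirdPrimitive_right hL (Lp.memLp W.fst.snd).neg (α * u₁ L + β * z 1)
  have hD : InDomain L α β u v z :=
    ⟨hu.memSobolev hL.le, hu.zero.memH10 hL u0 uL, hv.memSobolev hL.le, hv.zero.memH10 hL v0 vL,
      hz.memSobolev_one zero_le_one, u₁ L, z 1,
      by simpa [hu0] using hu.hasTrace_weakDeriv_one hL.le 0, hu.hasTrace_weakDeriv_one hL.le L,
      ⟨z, hz.continuousOn zero_le_one, ae_eq_refl _, by simp [z]⟩,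
      ⟨z, hz.continuousOn zero_le_one, ae_eq_refl _, rfl⟩,
      hvL ▸ hv.hasTrace_weakDeriv_one hL.le L⟩
  let U : H L β h := WithLp.toLp 2 (WithLp.toLp 2 (hD.u_H3.memLp.toLp u, hD.v_H3.memLp.toLp v),
    (memLp_weighted hD.z_H1.memLp).toLp z)
  have eu : U.fst.fst =ᵐ[volIoo 0 L] u := hD.u_H3.memLp.coeFn_toLp
  have ev : U.fst.snd =ᵐ[volIoo 0 L] v := hD.v_H3.memLp.coeFn_toLp
  have ez : U.snd =ᵐ[volIoo 0 1] z := by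
    have h1 := MemLp.coeFn_toLp (memLp_weighted (c := β * h) hD.z_H1.memLp)
    rwa [Filter.EventuallyEq, ae_weighted (mul_pos hβ hh)] at h1
  have hU : InDomain L α β U.fst.fst U.fst.snd U.snd :=
    hD.lin hD 1 0 (by simpa using eu) (by simpa using ev) (by simpa using ez)
  refine ⟨⟨U, hU⟩, ?_⟩
  change applyA h hU = W
  have e₁ : compU hU = W.fst.fst := by
    refine Lp.ext ?_
    filter_upwards [MemLp.coeFn_toLp ((hU.u_H3.weakDeriv_spec le_rfl).1.const_smul (1 / 2 : ℝ)),
      hu.weakDeriv_three_ae_eq hL.le eu hU.u_H3] with x h1 h2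
    rw [show compU hU x = _ from h1, Pi.smul_apply, h2, Pi.smul_apply, smul_eq_mul, smul_eq_mul]
    ring
  have e₂ : compV hU = W.fst.snd := by
    refine Lp.ext ?_
    filter_upwards [MemLp.coeFn_toLp (hU.v_H3.weakDeriv_spec le_rfl).1.neg,
      hv.weakDeriv_three_ae_eq hL.le ev hU.v_H3] with x h1 h2
    rw [show compV hU x = _ from h1, Pi.neg_apply, h2, Pi.neg_apply, neg_neg]
  have e₃ : compZ h hU = W.snd := by
    refine Lp.ext ?_
    have h2 : weakDeriv 0 1 1 U.snd =ᵐ[volIoo 0 1] (-h) • ⇑W.snd :=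
      (hU.z_H1.weakDeriv_spec le_rfl).2.ae_unique
        ((hz.hasWeakDeriv zero_le_one).congr_left ez) (hU.z_H1.weakDeriv_spec le_rfl).1 hz.memLp
    rw [Filter.EventuallyEq, ← ae_weighted (mul_pos hβ hh)] at h2
    filter_upwards [MemLp.coeFn_toLp (memLp_weighted (c := β * h)
      ((hU.z_H1.weakDeriv_spec le_rfl).1.const_smul (-(1 / h)))), h2] with x h1 h2
    rw [show compZ h hU x = _ from h1, Pi.smul_apply, h2, Pi.smul_apply, smul_eq_mul, smul_eq_mul]
    field_simp
  unfold applyA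
  rw [e₁, e₂, e₃]
  rfl

end HirotaSatsuma

theorem proposition2p1 (L α β h : ℝ) (hL : 0 < L) (hβ : 0 < β) (hh : 0 < h)
    (hcond : 0 < 2 * α ^ 2 + 3 / 2 * β ∧ 2 * α ^ 2 + 3 / 2 * β < 1 / 2) :
    GeneratesC0ContractionSemigroup (HirotaSatsuma.A L α β h hβ hh) :=
  generatesC0ContractionSemigroup _
    (HirotaSatsuma.A_inner_self_nonpos hL hβ hh hcond.2) (HirotaSatsuma.A_surjective hL hβ hh)
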